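/- **Theorem 1.1 (Local existence and uniqueness).** Let $N\ge 1$ be an integer, $\sigma\in(0,2]$, and $1<p<\infty$, with $p<\frac{N}{N-\sigma}$ if $\sigma<N$. Let $b$ be a real-valued function with $b\in L^\infty(0,1)$, and let $f:\mathbb R\to\mathbb R$ satisfy $f(0)=0$ and, for some constant $C_0$, $$|f(z)-f(w)|\le C_0\,(|z|^{p-1}+|w|^{p-1})\,|z-w|\qquad\text{for all } z,w\in\mathbb R .$$ Let $u_0\in H^{\sigma/2}(\mathbb R^N)$ and $u_1\in L^2(\mathbb R^N)$ be real-valued. Then there is $T\in(0,1]$ such that the problem $$\partial_t^2u+(-\Delta)^{\sigma/2}u+b(t)\,\partial_tu=f(u),\qquad u(0)=u_0,\quad \partial_tu(0)=u_1,$$ has one and only one real-valued mild solution $u\in C([0,T),H^{\sigma/2}(\mathbb R^N))\cap C^1([0,T),L^2(\mathbb R^N))$ on $[0,T)$. Here such a $u$ is called a mild solution if $u$ is bounded on $[0,T)$ with values in $H^{\sigma/2}$, $\partial_tu$ is bounded on $[0,T)$ with values in $L^2$, and, for all $t\in[0,T)$, $$u(t)=\tilde S_\sigma(t)u_0+S_\sigma(t)u_1-\int_0^tS_\sigma(t-\tau)\,b(\tau)\,\partial_\tau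 u(\tau)\,d\tau+\int_0^tS_\sigma(t-\tau)f(u(\tau))\,d\tau ,$$ where $f(u(\tau))\in L^2(\mathbb R^N)$ for every $\tau\in[0,T)$, the integrals are Bochner integrals in $L^2(\mathbb R^N)$, and $$S_\sigma(t)g=\mathcal F^{-1}\Big[\tfrac{\sin(t|\xi|^{\sigma/2})}{|\xi|^{\sigma/2}}\,\hat g\Big],\qquad \tilde S_\sigma(t)g=\mathcal F^{-1}\big[\cos(t|\xi|^{\sigma/2})\,\hat g\big].$$ -/

import Mathlib

open MeasureTheory Set Filter Topology FourierTransform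
open scoped ENNReal NNReal

noncomputable section

/-- The real Hilbert space `L²(ℝ^N)` of real-valued functions. -/
abbrev RealL2 (N : ℕ) : Type :=
  Lp ℝ 2 (volume : Measure (EuclideanSpace ℝ (Fin N)))

/-- The complex Hilbert space `L²(ℝ^N; ℂ)`. -/
abbrev ComplexL2 (N : ℕ) : Type :=
  Lp ℂ 2 (volume : Measure (EuclideanSpace ℝ (Fin N)))

/-- A real-valued `L²` function, regarded as a complex-valued one. -/
def complexify {N : ℕ} : RealL2 N →L[ℝ] ComplexL2 N :=
  Complex.ofRealCLM.compLpL 2 (volume : Measure (EuclideanSpace ℝ (Fin N)))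

/-- The modulus `|ξ|` of the angular frequency. Mathlib's Fourier transform has the kernel
`exp (-2 π i x · η)`, so that `η` stands for the angular frequency `ξ = 2 π η` of the convention with
kernel `(2 π)^(-N/2) exp (-i x · ξ)`. Both conventions are unitary on `L²`, and
`F⁻¹ [m(ξ) F g]` in the angular convention is `𝓕⁻ (m(2 π η) 𝓕 g)` in Mathlib's. -/
def angularFreq {N : ℕ} (η : EuclideanSpace ℝ (Fin N)) : ℝ :=
  2 * Real.pi * ‖η‖

/-- The norm `‖⟨∇⟩^s g‖_{L²} = ‖(1 + |ξ|²)^(s/2) F g‖_{L²}` of the Sobolev space `H^s(ℝ^N)`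
(`s ≥ 0`), with value `∞` when `g ∉ H^s`. -/
def sobolevENorm {N : ℕ} (s : ℝ) (g : RealL2 N) : ℝ≥0∞ :=
  eLpNorm (fun η : EuclideanSpace ℝ (Fin N) =>
    (((1 + angularFreq η ^ 2) ^ (s / 2) : ℝ) : ℂ) * (𝓕 (complexify g) : ComplexL2 N) η) 2 volume

/-- `g ∈ H^s(ℝ^N)`, for `s ≥ 0` and `g ∈ L²(ℝ^N)`. -/
def MemHs {N : ℕ} (s : ℝ) (g : RealL2 N) : Prop :=
  sobolevENorm s g < ∞

/-- The symbol `sin (t |ξ|^(σ/2)) / |ξ|^(σ/2)`. -/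
def sinSymbol (N : ℕ) (σ t : ℝ) (η : EuclideanSpace ℝ (Fin N)) : ℂ :=
  ((Real.sin (t * angularFreq η ^ (σ / 2)) / angularFreq η ^ (σ / 2) : ℝ) : ℂ)

/-- The symbol `cos (t |ξ|^(σ/2))`. -/
def cosSymbol (N : ℕ) (σ t : ℝ) (η : EuclideanSpace ℝ (Fin N)) : ℂ :=
  ((Real.cos (t * angularFreq η ^ (σ / 2)) : ℝ) : ℂ)

theorem measurable_angularFreq {N : ℕ} :
    Measurable (angularFreq : EuclideanSpace ℝ (Fin N) → ℝ) := by
  unfold angularFreq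
  fun_prop

theorem memLp_sinSymbol (N : ℕ) (σ t : ℝ) :
    MemLp (sinSymbol N σ t) ∞ (volume : Measure (EuclideanSpace ℝ (Fin N))) := by
  have hm := measurable_angularFreq (N := N)
  refine memLp_top_of_bound (C := |t|) ?_ (Eventually.of_forall fun η => ?_)
  · refine Measurable.aestronglyMeasurable ?_
    unfold sinSymbol
    fun_prop
  · rw [sinSymbol, Complex.norm_real, Real.norm_eq_abs, abs_div]
    refine div_le_of_le_mul₀ (abs_nonneg _) (abs_nonneg _) ?_
    rw [← abs_mul]
    exact Real.abs_sin_le_abs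

theorem memLp_cosSymbol (N : ℕ) (σ t : ℝ) :
    MemLp (cosSymbol N σ t) ∞ (volume : Measure (EuclideanSpace ℝ (Fin N))) := by
  have hm := measurable_angularFreq (N := N)
  refine memLp_top_of_bound (C := 1) ?_ (Eventually.of_forall fun η => ?_)
  · refine Measurable.aestronglyMeasurable ?_
    unfold cosSymbol
    fun_prop
  · rw [cosSymbol, Complex.norm_real, Real.norm_eq_abs]
    exact Real.abs_cos_le_one _

/-- The Fourier multiplier `g ↦ F⁻¹ [m F g]` on `L²`, for an essentially bounded symbol `m`. -/
def multiplierL2 {N : ℕ} (m : EuclideanSpace ℝ (Fin N) → ℂ) (hm : MemLp m ∞ volume)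
    (g : ComplexL2 N) : ComplexL2 N :=
  𝓕⁻ (hm.toLp m • 𝓕 g : ComplexL2 N)

/-- The operator `S_σ(t) g = F⁻¹ [sin (t |ξ|^(σ/2)) / |ξ|^(σ/2) F g]`. -/
def waveS {N : ℕ} (σ t : ℝ) (g : RealL2 N) : ComplexL2 N :=
  multiplierL2 (sinSymbol N σ t) (memLp_sinSymbol N σ t) (complexify g)

/-- The operator `S̃_σ(t) g = F⁻¹ [cos (t |ξ|^(σ/2)) F g]`. -/
def waveC {N : ℕ} (σ t : ℝ) (g : RealL2 N) : ComplexL2 N :=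
  multiplierL2 (cosSymbol N σ t) (memLp_cosSymbol N σ t) (complexify g)

/-- `u ∈ C([0,T), H^s(ℝ^N)) ∩ C¹([0,T), L²(ℝ^N))`. Only the values of `u` on `[0,T)` matter. -/
structure InSolutionSpace {N : ℕ} (s T : ℝ) (u : ℝ → RealL2 N) : Prop where
  memHs : ∀ t ∈ Ico 0 T, MemHs s (u t)
  continuous_Hs : ∀ t₀ ∈ Ico 0 T,
    Tendsto (fun t => sobolevENorm s (u t - u t₀)) (𝓝[Ico 0 T] t₀) (𝓝 0)
  contDiff_L2 : ContDiffOn ℝ 1 u (Ico 0 T)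

/-- The time derivative `∂_t u(t) ∈ L²(ℝ^N)`, `t ∈ [0,T)`, one-sided at `t = 0`. -/
def timeDeriv {N : ℕ} (T : ℝ) (u : ℝ → RealL2 N) (t : ℝ) : RealL2 N :=
  derivWithin u (Ico 0 T) t

/-- `u ∈ C([0,T), H^(σ/2)) ∩ C¹([0,T), L²)` is a mild solution of
`∂_t² u + (-Δ)^(σ/2) u + b(t) ∂_t u = f(u)`, `u(0) = u₀`, `∂_t u(0) = u₁`:
`u` is bounded in `H^(σ/2)`, `∂_t u` is bounded in `L²`, and
`u(t) = S̃(t) u₀ + S(t) u₁ - ∫₀ᵗ S(t-τ) b(τ) ∂_τ u(τ) dτ + ∫₀ᵗ S(t-τ) f(u(τ)) dτ`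
for all `t ∈ [0,T)`, where both integrals are (convergent) Bochner integrals in `L²`. -/
structure IsMildSolution {N : ℕ} (σ : ℝ) (b f : ℝ → ℝ) (u₀ u₁ : RealL2 N) (T : ℝ)
    (u : ℝ → RealL2 N) : Prop where
  mem_space : InSolutionSpace (σ / 2) T u
  bounded_Hs : ∃ M : ℝ≥0, ∀ t ∈ Ico 0 T, sobolevENorm (σ / 2) (u t) ≤ M
  bounded_timeDeriv : ∃ M : ℝ, ∀ t ∈ Ico 0 T, ‖timeDeriv T u t‖ ≤ M
  integral_eq : ∃ F : ℝ → RealL2 N,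
    (∀ t ∈ Ico 0 T, (F t : EuclideanSpace ℝ (Fin N) → ℝ) =ᵐ[volume] fun x => f (u t x)) ∧
    ∀ t ∈ Ico 0 T,
      IntervalIntegrable (fun τ => waveS σ (t - τ) (b τ • timeDeriv T u τ)) volume 0 t ∧
      IntervalIntegrable (fun τ => waveS σ (t - τ) (F τ)) volume 0 t ∧
      complexify (u t) = waveC σ t u₀ + waveS σ t u₁
        - (∫ τ in (0 : ℝ)..t, waveS σ (t - τ) (b τ • timeDeriv T u τ))
        + ∫ τ in (0 : ℝ)..t, waveS σ (t - τ) (F τ)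

end

/-!
With `Λ = ⟨∇⟩^(σ/2)`, the unknowns `w = Λ u` and `v = ∂_t u` both live in the real space `L²`, and a
mild solution is the same thing as a bounded continuous solution of the Volterra system
`(w, v)(t) = a(t) + ∫₀ᵗ K(t-τ) g(τ, (w, v)(τ)) dτ`, where
`K(t) y = (Λ S_σ(t) y, S̃_σ(t) y)` is strongly continuous and bounded for `0 ≤ t ≤ 1` (because
`Λ S_σ(t)` has the bounded symbol `⟨ξ⟩^(σ/2) sin (t |ξ|^(σ/2)) / |ξ|^(σ/2)`) and
`g(τ, (w, v)) = f(Λ⁻¹ w) - b(τ) v`. Once `g` is known to be Lipschitz in `(w, v)` on bounded sets,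
uniformly in `τ`, existence on a short interval is the contraction principle
(`exists_volterra_solution`), and uniqueness on that interval is the iteration of
`d(t) ≤ c ∫₀ᵗ d(τ) dτ` (`volterra_solution_unique`).

The analytic input is the subcritical embedding `H^(σ/2) ⊂ L^(2p)` (`exists_sobolev_embedding`). The
hypotheses on `p` amount to `N (p - 1) < σ p`, that is, `N (1 - 1/p) / 2 < σ / 2`. Bernstein's
inequality and interpolation between `L²` and `L^∞` bound the frequency block `|ξ| ~ 2ᵏ` of `u` in
`L^(2p)` by `2^(k (N (1 - 1/p) / 2 - σ / 2)) ‖u‖_{H^(σ/2)}`, which is summable in `k`. With Hölder's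
inequality this makes `u ↦ f(u)` Lipschitz from bounded sets of `H^(σ/2)` to `L²`
(`nemytskii_spec`).

The equivalence with the Volterra system (`isMildSolution_of_volterra`,
`IsMildSolution.exists_volterra`) needs that the mild formula may be differentiated in time although
`b` is only bounded and measurable: `∫₀ᵗ S_σ(t-τ) G(τ) dτ` has derivative `∫₀ᵗ S̃_σ(t-τ) G(τ) dτ` for
every bounded measurable `G` (`hasDerivAt_duhamel`). It also uses that radial real multipliers
preserve real-valued functions (`exists_realFourier_eq`), so that the whole argument takes place in
real spaces.
-/

/-! ### The Fourier transform of real-valued square-integrable functions -/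

open SchwartzMap in
/-- A square-integrable function whose `L²` Fourier transform is integrable is essentially bounded
by the `L¹` norm of that transform. -/
theorem ae_norm_le_integral_norm_fourier {N : ℕ} (g : ComplexL2 N)
    (hg : Integrable (𝓕 g : ComplexL2 N) volume) :
    ∀ᵐ x ∂(volume : Measure (EuclideanSpace ℝ (Fin N))),
      ‖g x‖ ≤ ∫ η, ‖(𝓕 g : ComplexL2 N) η‖ := by
  set V := EuclideanSpace ℝ (Fin N)
  set k : V → ℂ := VectorFourier.fourierIntegral Real.fourierChar volume (-innerₗ V).flip
    (𝓕 g : ComplexL2 N) with hk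
  have hflip : Continuous fun p : V × V => (-innerₗ V).flip p.1 p.2 := by
    have : (fun p : V × V => (-innerₗ V).flip p.1 p.2) = fun p => -(inner ℝ p.2 p.1) := by
      ext p; simp
    rw [this]; fun_prop
  have hflip' : Continuous fun p : V × V => (-innerₗ V) p.1 p.2 := by
    have : (fun p : V × V => (-innerₗ V) p.1 p.2) = fun p => -(inner ℝ p.1 p.2) := by
      ext p; simp
    rw [this]; fun_prop
  have hkc : Continuous k :=
    VectorFourier.fourierIntegral_continuous Real.continuous_fourierChar hflip hg
  have hgl : LocallyIntegrable g volume := (Lp.memLp g).locallyIntegrable (by norm_num)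
  have key : ∀ᵐ x ∂(volume : Measure V), g x = k x := by
    refine ae_eq_of_integral_contDiff_smul_eq hgl hkc.locallyIntegrable fun φ hφ hφc => ?_
    set ψ : 𝓢(V, ℂ) := (hφc.comp_left (g := ((↑) : ℝ → ℂ)) Complex.ofReal_zero).toSchwartzMap
      (Complex.ofRealCLM.contDiff.comp hφ) with hψ
    have hψe : ∀ x, ψ x = (φ x : ℂ) := fun x => rfl
    -- `g` is tested against `ψ` on the Fourier side, through tempered distributions
    have h1 : ∫ x, ψ x • g x = ∫ η, (𝓕⁻ ψ) η • (𝓕 g : ComplexL2 N) η := by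
      have h := congrArg (fun T : 𝓢'(V, ℂ) => T ψ)
        (Lp.fourierInv_toTemperedDistribution_eq (𝓕 g : ComplexL2 N))
      simp only [FourierTransform.fourierInv_fourier_eq, TemperedDistribution.fourierInv_apply,
        Lp.toTemperedDistribution_apply] at h
      exact h.symm
    have h2 : ∫ η, (𝓕⁻ ψ) η • (𝓕 g : ComplexL2 N) η = ∫ x, ψ x • k x := by
      have h := VectorFourier.integral_fourierIntegral_smul_eq_flip (μ := (volume : Measure V))
        (ν := (volume : Measure V)) (L := -innerₗ V) Real.continuous_fourierChar
        hflip' ψ.integrable hg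
      rw [← h, SchwartzMap.fourierInv_coe]
      rfl
    have h3 : ∀ F : V → ℂ, ∫ x, φ x • F x = ∫ x, ψ x • F x := fun F => by
      refine integral_congr_ae (Eventually.of_forall fun x => ?_)
      simp only [hψe, Complex.real_smul, smul_eq_mul]
    rw [h3, h3, h1, h2]
  filter_upwards [key] with x hx
  rw [hx, hk]
  exact VectorFourier.norm_fourierIntegral_le_integral_norm _ _ _ _ _

/-- Complex conjugation on `L²(ℝ^N; ℂ)`. -/
noncomputable def conjL2 {N : ℕ} : ComplexL2 N →L[ℝ] ComplexL2 N :=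
  Complex.conjCLE.toContinuousLinearMap.compLpL 2 (volume : Measure (EuclideanSpace ℝ (Fin N)))

/-- The reflection `h(η) ↦ h(-η)` on `L²(ℝ^N; ℂ)`. -/
noncomputable def reflectL2 {N : ℕ} : ComplexL2 N →+ ComplexL2 N :=
  Lp.compMeasurePreserving (fun x => -x) (Measure.measurePreserving_neg volume)

theorem coeFn_conjL2 {N : ℕ} (h : ComplexL2 N) :
    conjL2 h =ᵐ[volume] fun x => (starRingEnd ℂ) (h x) :=
  ContinuousLinearMap.coeFn_compLpL _ _

theorem coeFn_reflectL2 {N : ℕ} (h : ComplexL2 N) :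
    reflectL2 h =ᵐ[volume] fun x => h (-x) :=
  Lp.coeFn_compMeasurePreserving _ _

open SchwartzMap in
/-- `F (conj g) (η) = conj (F g (-η))` on `L²`, by density of the Schwartz functions. -/
theorem fourier_conjL2 {N : ℕ} (g : ComplexL2 N) :
    (𝓕 (conjL2 g) : ComplexL2 N) = conjL2 (reflectL2 (𝓕 g)) := by
  refine DenseRange.induction_on
    (p := fun g : ComplexL2 N => (𝓕 (conjL2 g) : ComplexL2 N) = conjL2 (reflectL2 (𝓕 g)))
    (SchwartzMap.denseRange_toLpCLM (F := ℂ) (μ := volume) (p := 2) ENNReal.ofNat_ne_top) g ?_ ?_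
  · have hr : Continuous (reflectL2 : ComplexL2 N → ComplexL2 N) :=
      (Lp.isometry_compMeasurePreserving _).continuous
    exact isClosed_eq (continuous_fourier.comp conjL2.continuous)
      (conjL2.continuous.comp (hr.comp continuous_fourier))
  · intro φ
    set ψ : 𝓢(EuclideanSpace ℝ (Fin N), ℂ) :=
      φ.postcompCLM (𝕜 := ℝ) Complex.conjCLE.toContinuousLinearMap with hψ
    have h1 : conjL2 (φ.toLp 2 volume) = ψ.toLp 2 volume := by
      refine Lp.ext ?_
      filter_upwards [coeFn_conjL2 (φ.toLp 2 volume), φ.coeFn_toLp 2 volume,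
        ψ.coeFn_toLp 2 volume] with x h1 h2 h3
      rw [h1, h2, h3]; rfl
    have h2 : ∀ η, (𝓕 ψ) η = (starRingEnd ℂ) ((𝓕 φ) (-η)) := by
      intro η
      rw [SchwartzMap.fourier_coe, SchwartzMap.fourier_coe, Real.fourier_eq', Real.fourier_eq',
        ← integral_conj]
      refine integral_congr_ae (Eventually.of_forall fun x => ?_)
      simp only [smul_eq_mul, map_mul, ← Complex.exp_conj]
      refine congrArg₂ (· * ·) (congrArg Complex.exp ?_) rfl
      simp [Complex.conj_ofNat]
    simp only [toLpCLM_apply]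
    rw [h1, SchwartzMap.toLp_fourier_eq, SchwartzMap.toLp_fourier_eq]
    refine Lp.ext ?_
    have h3 := (Measure.measurePreserving_neg
      (volume : Measure (EuclideanSpace ℝ (Fin N)))).quasiMeasurePreserving.ae
      ((𝓕 φ).coeFn_toLp 2 volume)
    filter_upwards [coeFn_conjL2 (reflectL2 ((𝓕 φ).toLp 2 volume)),
      coeFn_reflectL2 ((𝓕 φ).toLp 2 volume), (𝓕 ψ).coeFn_toLp 2 volume, h3] with x a1 a2 a3 a4
    rw [a1, a2, a3, a4, h2]

theorem coeFn_complexify {N : ℕ} (g : RealL2 N) :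
    complexify g =ᵐ[volume] fun x => (g x : ℂ) :=
  ContinuousLinearMap.coeFn_compLpL _ _

theorem norm_complexify {N : ℕ} (g : RealL2 N) : ‖complexify g‖ = ‖g‖ := by
  rw [Lp.norm_def, Lp.norm_def]
  congr 1
  refine eLpNorm_congr_norm_ae ?_
  filter_upwards [coeFn_complexify g] with x hx
  simp [hx]

/-- The Fourier transform of a real-valued square-integrable function. -/
noncomputable def realFourier {N : ℕ} : RealL2 N →ₗᵢ[ℝ] ComplexL2 N where
  toFun g := 𝓕 (complexify g)
  map_add' f g := by rw [map_add, FourierTransform.fourier_add]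
  map_smul' c g := by
    rw [map_smul, RingHom.id_apply]
    have h := FourierTransform.fourier_smul (c : ℂ) (complexify g)
    rw [Complex.coe_smul, Complex.coe_smul] at h
    exact h
  norm_map' g := by
    change ‖(𝓕 (complexify g) : ComplexL2 N)‖ = ‖g‖
    rw [Lp.norm_fourier_eq, norm_complexify]

theorem realFourier_apply {N : ℕ} (g : RealL2 N) : realFourier g = 𝓕 (complexify g) := rfl

theorem conjL2_complexify {N : ℕ} (g : RealL2 N) : conjL2 (complexify g) = complexify g := by
  refine Lp.ext ?_
  filter_upwards [coeFn_conjL2 (complexify g), coeFn_complexify g] with x h1 h2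
  rw [h1, h2, Complex.conj_ofReal]

theorem realFourier_neg {N : ℕ} (g : RealL2 N) :
    ∀ᵐ η, realFourier g η = (starRingEnd ℂ) (realFourier g (-η)) := by
  have h := fourier_conjL2 (complexify g)
  rw [conjL2_complexify, ← realFourier_apply] at h
  filter_upwards [coeFn_conjL2 (reflectL2 (realFourier g)), coeFn_reflectL2 (realFourier g)]
    with η h1 h2
  rw [← h2, ← h1, ← h]

/-- A square-integrable `h` with `h(η) = conj h(-η)` is the Fourier transform of a real-valued
function. -/
theorem exists_realFourier_eq {N : ℕ} (h : ComplexL2 N)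
    (hh : ∀ᵐ η, h η = (starRingEnd ℂ) (h (-η))) : ∃ g : RealL2 N, realFourier g = h := by
  set k : ComplexL2 N := 𝓕⁻ h with hk
  have hk' : (𝓕 k : ComplexL2 N) = h := FourierTransform.fourier_fourierInv_eq h
  have h1 : conjL2 k = k := by
    have h2 : (𝓕 (conjL2 k) : ComplexL2 N) = 𝓕 k := by
      rw [fourier_conjL2, hk']
      refine Lp.ext ?_
      filter_upwards [coeFn_conjL2 (reflectL2 h), coeFn_reflectL2 h, hh] with η a1 a2 a3
      rw [a1, a2, ← a3]
    have h3 := congrArg (fun q : ComplexL2 N => (𝓕⁻ q : ComplexL2 N)) h2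
    simpa only [FourierTransform.fourierInv_fourier_eq] using h3
  refine ⟨Complex.reCLM.compLpL 2 volume k, ?_⟩
  rw [realFourier_apply, ← hk']
  congr 1
  refine Lp.ext ?_
  have h4 := coeFn_conjL2 k
  rw [h1] at h4
  filter_upwards [coeFn_complexify (Complex.reCLM.compLpL 2 volume k),
    ContinuousLinearMap.coeFn_compLpL (p := 2) Complex.reCLM k, h4] with x a1 a2 a3
  rw [a1, a2]
  exact Complex.conj_eq_iff_re.mp a3.symm

/-! ### Radial Fourier multipliers on real-valued functions -/

theorem angularFreq_nonneg {N : ℕ} (η : EuclideanSpace ℝ (Fin N)) : 0 ≤ angularFreq η := by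
  unfold angularFreq; positivity

theorem angularFreq_neg {N : ℕ} (η : EuclideanSpace ℝ (Fin N)) :
    angularFreq (-η) = angularFreq η := by
  simp [angularFreq]

theorem ae_angularFreq_pos {N : ℕ} (hN : 0 < N) :
    ∀ᵐ η ∂(volume : Measure (EuclideanSpace ℝ (Fin N))), 0 < angularFreq η := by
  have : Nonempty (Fin N) := ⟨⟨0, hN⟩⟩
  have h : ∀ᵐ η ∂(volume : Measure (EuclideanSpace ℝ (Fin N))), η ≠ 0 := by
    simp [ae_iff]
  filter_upwards [h] with η hη
  have := norm_pos_iff.mpr hη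
  unfold angularFreq
  positivity

/-- A real radial multiplier maps real functions to real functions, wherever it is defined. -/
theorem exists_realFourier_eq_mul {N : ℕ} (m : ℝ → ℝ) (g : RealL2 N)
    (hm : MemLp (fun η => (m (angularFreq η) : ℂ) * realFourier g η) 2 volume) :
    ∃ w : RealL2 N,
      realFourier w =ᵐ[volume] fun η => (m (angularFreq η) : ℂ) * realFourier g η := by
  obtain ⟨w, hw⟩ := exists_realFourier_eq (hm.toLp _) (by
    have h1 := (Measure.measurePreserving_neg
      (volume : Measure (EuclideanSpace ℝ (Fin N)))).quasiMeasurePreserving.ae hm.coeFn_toLp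
    filter_upwards [hm.coeFn_toLp, h1, realFourier_neg g] with η a1 a2 a3
    rw [a1, a2, map_mul, ← a3, angularFreq_neg, Complex.conj_ofReal])
  exact ⟨w, hw ▸ hm.coeFn_toLp⟩

/-- The symbols of bounded radial Fourier multipliers, as functions of `|ξ| ≥ 0`. -/
structure IsRadialSymbol (m : ℝ → ℝ) : Prop where
  measurable : Measurable m
  bounded : ∃ C, ∀ r, 0 ≤ r → |m r| ≤ C

theorem IsRadialSymbol.of_bound {m : ℝ → ℝ} (hm : Measurable m) {C : ℝ}
    (hC : ∀ r, 0 ≤ r → |m r| ≤ C) : IsRadialSymbol m :=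
  ⟨hm, C, hC⟩

theorem IsRadialSymbol.memLp {N : ℕ} {m : ℝ → ℝ} (hm : IsRadialSymbol m) (g : RealL2 N) :
    MemLp (fun η => (m (angularFreq η) : ℂ) * realFourier g η) 2 volume := by
  obtain ⟨C, hC⟩ := hm.bounded
  have hmeas := hm.measurable
  have hang := measurable_angularFreq (N := N)
  refine (Lp.memLp (realFourier g)).of_le_mul (c := C) ?_ (Eventually.of_forall fun η => ?_)
  · exact (Measurable.aestronglyMeasurable (by fun_prop)).mul (Lp.aestronglyMeasurable _)
  · rw [norm_mul, Complex.norm_real, Real.norm_eq_abs]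
    exact mul_le_mul_of_nonneg_right (hC _ (angularFreq_nonneg η)) (norm_nonneg _)

theorem ext_realFourier {N : ℕ} {g h : RealL2 N} (H : realFourier g =ᵐ[volume] realFourier h) :
    g = h :=
  realFourier.injective (Lp.ext H)

theorem norm_le_of_realFourier_eq_mul {N : ℕ} {w g : RealL2 N} {m : ℝ → ℝ} {C : ℝ}
    (hm : ∀ᵐ η, realFourier g η ≠ 0 → |m (angularFreq (N := N) η)| ≤ C)
    (hw : realFourier w =ᵐ[volume] fun η => (m (angularFreq η) : ℂ) * realFourier g η) :
    ‖w‖ ≤ C * ‖g‖ := by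
  rw [← realFourier.norm_map w, ← realFourier.norm_map g]
  refine Lp.norm_le_mul_norm_of_ae_le_mul ?_
  filter_upwards [hw, hm] with η hη h'
  rw [hη, norm_mul, Complex.norm_real, Real.norm_eq_abs]
  by_cases h0 : realFourier g η = 0
  · simp [h0]
  · exact mul_le_mul_of_nonneg_right (h' h0) (norm_nonneg _)

theorem eq_add_of_realFourier_eq_mul {N : ℕ} {m : ℝ → ℝ} {f g u v w : RealL2 N}
    (hu : realFourier u =ᵐ[volume] fun η => (m (angularFreq η) : ℂ) * realFourier f η)
    (hv : realFourier v =ᵐ[volume] fun η => (m (angularFreq η) : ℂ) * realFourier g η)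
    (hw : realFourier w =ᵐ[volume] fun η => (m (angularFreq η) : ℂ) * realFourier (f + g) η) :
    w = u + v := by
  refine ext_realFourier ?_
  rw [map_add] at hw ⊢
  filter_upwards [hu, hv, hw, Lp.coeFn_add (realFourier f) (realFourier g),
    Lp.coeFn_add (realFourier u) (realFourier v)] with η h1 h2 h3 h4 h5
  rw [h5, h3, h4, Pi.add_apply, Pi.add_apply, h1, h2]
  ring

theorem eq_smul_of_realFourier_eq_mul {N : ℕ} {m : ℝ → ℝ} {c : ℝ} {g v w : RealL2 N}
    (hv : realFourier v =ᵐ[volume] fun η => (m (angularFreq η) : ℂ) * realFourier g η)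
    (hw : realFourier w =ᵐ[volume] fun η => (m (angularFreq η) : ℂ) * realFourier (c • g) η) :
    w = c • v := by
  refine ext_realFourier ?_
  rw [map_smul] at hw ⊢
  filter_upwards [hv, hw, Lp.coeFn_smul c (realFourier g), Lp.coeFn_smul c (realFourier v)]
    with η h1 h2 h3 h4
  rw [h4, h2, h3, Pi.smul_apply, Pi.smul_apply, h1]
  simp only [Complex.real_smul]
  ring

open Classical in
/-- The Fourier multiplier with symbol `m(|ξ|)` on real-valued functions; it is zero when `m` is
not a radial symbol. -/
noncomputable def radialOp {N : ℕ} (m : ℝ → ℝ) : RealL2 N →L[ℝ] RealL2 N :=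
  if hm : IsRadialSymbol m then
    LinearMap.mkContinuousOfExistsBound
      { toFun := fun g => (exists_realFourier_eq_mul m g (hm.memLp g)).choose
        map_add' := fun f g => eq_add_of_realFourier_eq_mul
          (exists_realFourier_eq_mul m f (hm.memLp f)).choose_spec
          (exists_realFourier_eq_mul m g (hm.memLp g)).choose_spec
          (exists_realFourier_eq_mul m (f + g) (hm.memLp (f + g))).choose_spec
        map_smul' := fun c g => eq_smul_of_realFourier_eq_mul
          (exists_realFourier_eq_mul m g (hm.memLp g)).choose_spec
          (exists_realFourier_eq_mul m (c • g) (hm.memLp (c • g))).choose_spec }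
      (by
        obtain ⟨C, hC⟩ := hm.bounded
        exact ⟨C, fun g => norm_le_of_realFourier_eq_mul
          (Eventually.of_forall fun η _ => hC _ (angularFreq_nonneg η))
          (exists_realFourier_eq_mul m g (hm.memLp g)).choose_spec⟩)
  else 0

theorem realFourier_radialOp {N : ℕ} {m : ℝ → ℝ} (hm : IsRadialSymbol m) (g : RealL2 N) :
    realFourier (radialOp m g) =ᵐ[volume]
      fun η => (m (angularFreq η) : ℂ) * realFourier g η := by
  rw [radialOp, dif_pos hm]
  exact (exists_realFourier_eq_mul m g (hm.memLp g)).choose_spec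

theorem norm_radialOp_le {N : ℕ} {m : ℝ → ℝ} (hm : Measurable m) {C : ℝ}
    (hC : ∀ r, 0 ≤ r → |m r| ≤ C) (g : RealL2 N) : ‖radialOp m g‖ ≤ C * ‖g‖ :=
  norm_le_of_realFourier_eq_mul
    (Eventually.of_forall fun η _ => hC _ (angularFreq_nonneg η))
    (realFourier_radialOp (.of_bound hm hC) g)

theorem radialOp_radialOp {N : ℕ} {m₁ m₂ m₃ : ℝ → ℝ} (h₁ : IsRadialSymbol m₁)
    (h₂ : IsRadialSymbol m₂) (h₃ : IsRadialSymbol m₃) (h : ∀ r, 0 ≤ r → m₁ r * m₂ r = m₃ r)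
    (g : RealL2 N) : radialOp m₁ (radialOp m₂ g) = radialOp m₃ g := by
  refine ext_realFourier ?_
  filter_upwards [realFourier_radialOp h₁ (radialOp m₂ g), realFourier_radialOp h₂ g,
    realFourier_radialOp h₃ g] with η a1 a2 a3
  rw [a1, a2, a3, ← h _ (angularFreq_nonneg η)]
  push_cast
  ring

theorem norm_sq_eq_integral {N : ℕ} (h : ComplexL2 N) : ‖h‖ ^ 2 = ∫ η, ‖h η‖ ^ 2 := by
  have h1 := @inner_self_eq_norm_sq ℂ _ _ _ _ h
  rw [L2.inner_def] at h1
  rw [← h1, ← integral_re (L2.integrable_inner h h)]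
  refine integral_congr_ae (Eventually.of_forall fun η => ?_)
  exact Eq.symm <| (@inner_self_eq_norm_sq ℂ _ _ _ _ (h η)).symm

/-- Dominated convergence on the Fourier side: if the symbols are uniformly bounded and converge
at all positive frequencies, the multipliers converge strongly. -/
theorem tendsto_of_realFourier_eq_mul {N : ℕ} (hN : 0 < N) {ι : Type*} {l : Filter ι}
    [l.IsCountablyGenerated] {a : ι → ℝ → ℝ} {a₀ : ℝ → ℝ} {C : ℝ} {g : RealL2 N}
    {x : ι → RealL2 N} {x₀ : RealL2 N}
    (hx : ∀ i, realFourier (x i) =ᵐ[volume] fun η => (a i (angularFreq η) : ℂ) * realFourier g η)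
    (hx₀ : realFourier x₀ =ᵐ[volume] fun η => (a₀ (angularFreq η) : ℂ) * realFourier g η)
    (hC : ∀ᶠ i in l, ∀ r, 0 < r → |a i r - a₀ r| ≤ C)
    (hlim : ∀ r, 0 < r → Tendsto (fun i => a i r) l (𝓝 (a₀ r))) :
    Tendsto x l (𝓝 x₀) := by
  have hdiff : ∀ i, realFourier (x i - x₀) =ᵐ[volume]
      fun η => ((a i (angularFreq η) - a₀ (angularFreq η) : ℝ) : ℂ) * realFourier g η := by
    intro i
    rw [map_sub]
    filter_upwards [hx i, hx₀, Lp.coeFn_sub (realFourier (x i)) (realFourier x₀)] with η h1 h2 h3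
    rw [h3, Pi.sub_apply, h1, h2]
    push_cast
    ring
  have hnorm : ∀ i, ‖x i - x₀‖ ^ 2 =
      ∫ η, ‖((a i (angularFreq η) - a₀ (angularFreq η) : ℝ) : ℂ) * realFourier g η‖ ^ 2 :=
    fun i => by
      rw [← realFourier.norm_map, norm_sq_eq_integral]
      refine integral_congr_ae ?_
      filter_upwards [hdiff i] with η h1
      rw [h1]
  have hsq : Tendsto (fun i => ‖x i - x₀‖ ^ 2) l (𝓝 0) := by
    simp_rw [hnorm]
    have hint : Integrable (fun η => C ^ 2 * ‖realFourier g η‖ ^ 2) volume :=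
      ((Lp.memLp (realFourier g)).integrable_norm_pow (by norm_num)).const_mul _
    have := tendsto_integral_filter_of_dominated_convergence (μ := volume) (l := l)
      (F := fun i η =>
        ‖((a i (angularFreq η) - a₀ (angularFreq η) : ℝ) : ℂ) * realFourier g η‖ ^ 2)
      (f := fun _ => (0 : ℝ)) _
      (Eventually.of_forall fun i =>
        (((Lp.aestronglyMeasurable _).congr (hdiff i)).norm.pow 2)) ?_ hint ?_
    · simpa using this
    · filter_upwards [hC] with i hi
      filter_upwards [ae_angularFreq_pos hN] with η h2
      rw [norm_pow, norm_norm, norm_mul, mul_pow, Complex.norm_real, Real.norm_eq_abs]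
      have := hi _ h2
      gcongr
    · filter_upwards [ae_angularFreq_pos hN] with η h2
      have h3 : Tendsto (fun i => a i (angularFreq η) - a₀ (angularFreq η)) l (𝓝 0) := by
        simpa using (hlim _ h2).sub_const (a₀ (angularFreq η))
      have h4 := (((Complex.continuous_ofReal.tendsto _).comp h3).mul_const
        (realFourier g η)).norm.pow 2
      simpa using h4
  have h2 := hsq.sqrt
  simp only [Real.sqrt_sq (norm_nonneg _), Real.sqrt_zero] at h2
  exact tendsto_iff_norm_sub_tendsto_zero.mpr h2

/-! ### The propagators as radial multipliers -/

/-- The propagator `S̃_σ(t)` on real-valued functions. -/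
noncomputable def cosOp {N : ℕ} (σ t : ℝ) : RealL2 N →L[ℝ] RealL2 N :=
  radialOp fun r => Real.cos (t * r ^ (σ / 2))

/-- The propagator `S_σ(t)` on real-valued functions. -/
noncomputable def sinOp {N : ℕ} (σ t : ℝ) : RealL2 N →L[ℝ] RealL2 N :=
  radialOp fun r => Real.sin (t * r ^ (σ / 2)) / r ^ (σ / 2)

/-- The Bessel potential `⟨∇⟩^(-σ/2)`, an isometry of `L²` onto `H^(σ/2)`. -/
noncomputable def besselOp {N : ℕ} (σ : ℝ) : RealL2 N →L[ℝ] RealL2 N :=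
  radialOp fun r => (1 + r ^ 2) ^ (-(σ / 2 / 2))

/-- The operator `⟨∇⟩^(σ/2) S_σ(t)`, bounded on `L²`. -/
noncomputable def liftedSinOp {N : ℕ} (σ t : ℝ) : RealL2 N →L[ℝ] RealL2 N :=
  radialOp fun r => (1 + r ^ 2) ^ (σ / 2 / 2) * (Real.sin (t * r ^ (σ / 2)) / r ^ (σ / 2))

/-- The time derivative of `S̃_σ(t) ⟨∇⟩^(-σ/2)`, bounded on `L²`. -/
noncomputable def derivCosOp {N : ℕ} (σ t : ℝ) : RealL2 N →L[ℝ] RealL2 N :=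
  radialOp fun r => (1 + r ^ 2) ^ (-(σ / 2 / 2)) *
    (-Real.sin (t * r ^ (σ / 2)) * r ^ (σ / 2))

theorem abs_sin_mul_div_le (t a : ℝ) : |Real.sin (t * a) / a| ≤ |t| := by
  rw [abs_div]
  refine div_le_of_le_mul₀ (abs_nonneg _) (abs_nonneg _) ?_
  rw [← abs_mul]
  exact Real.abs_sin_le_abs

theorem rpow_le_bracket {σ r : ℝ} (hσ₀ : 0 ≤ σ) (hr : 0 ≤ r) :
    r ^ (σ / 2) ≤ (1 + r ^ 2) ^ (σ / 2 / 2) := by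
  have h : r ^ (σ / 2) = (r ^ 2) ^ (σ / 2 / 2) := by
    rw [← Real.rpow_natCast, ← Real.rpow_mul hr]; congr 1; push_cast; ring
  rw [h]
  exact Real.rpow_le_rpow (by positivity) (by linarith) (by linarith)

theorem bracket_le_one_add_rpow {σ r : ℝ} (hσ₀ : 0 ≤ σ) (hσ₂ : σ ≤ 2) (hr : 0 ≤ r) :
    (1 + r ^ 2) ^ (σ / 2 / 2) ≤ 1 + r ^ (σ / 2) := by
  have h : r ^ (σ / 2) = (r ^ 2) ^ (σ / 2 / 2) := by
    rw [← Real.rpow_natCast, ← Real.rpow_mul hr]; congr 1; push_cast; ring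
  rw [h]
  have h1 := Real.rpow_add_le_add_rpow (zero_le_one (α := ℝ)) (sq_nonneg r)
    (p := σ / 2 / 2) (by linarith) (by linarith)
  simpa using h1

theorem bracket_mul_bracket_neg (σ r : ℝ) :
    (1 + r ^ 2) ^ (σ / 2 / 2) * (1 + r ^ 2) ^ (-(σ / 2 / 2)) = 1 := by
  have : 0 < 1 + r ^ 2 := by positivity
  rw [← Real.rpow_add this, add_neg_cancel, Real.rpow_zero]

theorem abs_bracket_neg_le {σ : ℝ} (hσ₀ : 0 ≤ σ) (r : ℝ) :
    |(1 + r ^ 2) ^ (-(σ / 2 / 2))| ≤ 1 := by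
  rw [abs_of_nonneg (by positivity)]
  exact Real.rpow_le_one_of_one_le_of_nonpos (by nlinarith) (by linarith)

theorem abs_liftedSin_le {σ : ℝ} (hσ₀ : 0 ≤ σ) (hσ₂ : σ ≤ 2) (t : ℝ) {r : ℝ} (hr : 0 ≤ r) :
    |(1 + r ^ 2) ^ (σ / 2 / 2) * (Real.sin (t * r ^ (σ / 2)) / r ^ (σ / 2))| ≤ 1 + |t| := by
  have h1 := bracket_le_one_add_rpow hσ₀ hσ₂ hr
  have h2 := abs_sin_mul_div_le t (r ^ (σ / 2))
  have h0 : 0 ≤ r ^ (σ / 2) := by positivity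
  rw [abs_mul, abs_of_nonneg (by positivity : 0 ≤ (1 + r ^ 2) ^ (σ / 2 / 2))]
  set q := |Real.sin (t * r ^ (σ / 2)) / r ^ (σ / 2)| with hq
  have h3 : r ^ (σ / 2) * q ≤ 1 := by
    rcases h0.eq_or_lt with h | h
    · rw [← h, zero_mul]; exact zero_le_one
    · rw [hq, abs_div, abs_of_pos h, mul_div_cancel₀ _ h.ne']
      exact Real.abs_sin_le_one _
  have hq0 : 0 ≤ q := abs_nonneg _
  nlinarith

theorem abs_derivCos_le {σ : ℝ} (hσ₀ : 0 ≤ σ) (t : ℝ) {r : ℝ} (hr : 0 ≤ r) :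
    |(1 + r ^ 2) ^ (-(σ / 2 / 2)) * (-Real.sin (t * r ^ (σ / 2)) * r ^ (σ / 2))| ≤ 1 := by
  have h0 : 0 ≤ r ^ (σ / 2) := by positivity
  have hb : 0 < (1 + r ^ 2) ^ (-(σ / 2 / 2)) := by positivity
  have h1 := rpow_le_bracket hσ₀ hr
  have h2 := bracket_mul_bracket_neg σ r
  rw [abs_mul, abs_mul, abs_neg, abs_of_pos hb, abs_of_nonneg h0]
  have h3 := Real.abs_sin_le_one (t * r ^ (σ / 2))
  calc _ ≤ (1 + r ^ 2) ^ (-(σ / 2 / 2)) * (1 * (1 + r ^ 2) ^ (σ / 2 / 2)) := by gcongr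
    _ = 1 := by rw [one_mul, mul_comm, h2]

theorem isRadialSymbol_cos (σ t : ℝ) : IsRadialSymbol fun r => Real.cos (t * r ^ (σ / 2)) :=
  .of_bound (by fun_prop) fun _ _ => Real.abs_cos_le_one _

theorem isRadialSymbol_sin (σ t : ℝ) :
    IsRadialSymbol fun r => Real.sin (t * r ^ (σ / 2)) / r ^ (σ / 2) :=
  .of_bound (by fun_prop) fun _ _ => abs_sin_mul_div_le _ _

theorem isRadialSymbol_bessel {σ : ℝ} (hσ₀ : 0 ≤ σ) :
    IsRadialSymbol fun r => (1 + r ^ 2) ^ (-(σ / 2 / 2)) :=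
  .of_bound (by fun_prop) fun r _ => abs_bracket_neg_le hσ₀ r

theorem isRadialSymbol_liftedSin {σ : ℝ} (hσ₀ : 0 ≤ σ) (hσ₂ : σ ≤ 2) (t : ℝ) :
    IsRadialSymbol fun r =>
      (1 + r ^ 2) ^ (σ / 2 / 2) * (Real.sin (t * r ^ (σ / 2)) / r ^ (σ / 2)) :=
  .of_bound (by fun_prop) fun _ hr => abs_liftedSin_le hσ₀ hσ₂ t hr

theorem isRadialSymbol_derivCos {σ : ℝ} (hσ₀ : 0 ≤ σ) (t : ℝ) :
    IsRadialSymbol fun r =>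
      (1 + r ^ 2) ^ (-(σ / 2 / 2)) * (-Real.sin (t * r ^ (σ / 2)) * r ^ (σ / 2)) :=
  .of_bound (by fun_prop) fun _ hr => abs_derivCos_le hσ₀ t hr

section Propagators

variable {N : ℕ} {σ : ℝ}

theorem norm_cosOp_le (t : ℝ) (g : RealL2 N) : ‖cosOp σ t g‖ ≤ ‖g‖ :=
  (norm_radialOp_le (by fun_prop) (fun _ _ => Real.abs_cos_le_one _) g).trans_eq (one_mul _)

theorem norm_liftedSinOp_le (hσ₀ : 0 ≤ σ) (hσ₂ : σ ≤ 2) (t : ℝ) (g : RealL2 N) :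
    ‖liftedSinOp σ t g‖ ≤ (1 + |t|) * ‖g‖ :=
  norm_radialOp_le (by fun_prop) (fun _ hr => abs_liftedSin_le hσ₀ hσ₂ t hr) g

theorem besselOp_cosOp (hσ₀ : 0 ≤ σ) (t : ℝ) (g : RealL2 N) :
    besselOp σ (cosOp σ t g) = cosOp σ t (besselOp σ g) := by
  have h3 : IsRadialSymbol fun r =>
      (1 + r ^ 2) ^ (-(σ / 2 / 2)) * Real.cos (t * r ^ (σ / 2)) := by
    refine .of_bound (C := 1) (by fun_prop) fun r _ => ?_
    rw [abs_mul]
    exact mul_le_one₀ (abs_bracket_neg_le hσ₀ r) (abs_nonneg _) (Real.abs_cos_le_one _)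
  rw [besselOp, cosOp,
    radialOp_radialOp (isRadialSymbol_bessel hσ₀) (isRadialSymbol_cos σ t) h3 (fun _ _ => rfl),
    radialOp_radialOp (isRadialSymbol_cos σ t) (isRadialSymbol_bessel hσ₀) h3
      (fun _ _ => mul_comm _ _)]

theorem besselOp_liftedSinOp (hσ₀ : 0 ≤ σ) (hσ₂ : σ ≤ 2) (t : ℝ) (g : RealL2 N) :
    besselOp σ (liftedSinOp σ t g) = sinOp σ t g := by
  refine radialOp_radialOp (isRadialSymbol_bessel hσ₀) (isRadialSymbol_liftedSin hσ₀ hσ₂ t)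
    (isRadialSymbol_sin σ t) (fun r _ => ?_) g
  rw [← mul_assoc, mul_comm (_ ^ _), bracket_mul_bracket_neg, one_mul]

theorem complexify_eq_multiplierL2 {w g : RealL2 N} {m : EuclideanSpace ℝ (Fin N) → ℂ}
    (hm : MemLp m ∞ volume) (hw : realFourier w =ᵐ[volume] fun η => m η * realFourier g η) :
    complexify w = multiplierL2 m hm (complexify g) := by
  have h : realFourier w = hm.toLp m • realFourier g := by
    refine Lp.ext ?_
    filter_upwards [hw, hm.coeFn_toLp, Lp.coeFn_lpSMul (r := 2) (hm.toLp m) (realFourier g)]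
      with η h1 h2 h3
    rw [h1, h3, Pi.smul_apply', h2, smul_eq_mul]
  rw [multiplierL2, ← realFourier_apply, ← h, realFourier_apply,
    FourierTransform.fourierInv_fourier_eq]

theorem complexify_cosOp (t : ℝ) (g : RealL2 N) : complexify (cosOp σ t g) = waveC σ t g :=
  complexify_eq_multiplierL2 _ (realFourier_radialOp (isRadialSymbol_cos σ t) g)

theorem complexify_sinOp (t : ℝ) (g : RealL2 N) : complexify (sinOp σ t g) = waveS σ t g :=
  complexify_eq_multiplierL2 _ (realFourier_radialOp (isRadialSymbol_sin σ t) g)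

theorem sobolevENorm_besselOp (hσ₀ : 0 ≤ σ) (w : RealL2 N) :
    sobolevENorm (σ / 2) (besselOp σ w) = ‖w‖ₑ := by
  rw [← realFourier.enorm_map, Lp.enorm_def]
  refine eLpNorm_congr_ae ?_
  filter_upwards [realFourier_radialOp (isRadialSymbol_bessel hσ₀) w] with η h1
  rw [← realFourier_apply, besselOp, h1, ← mul_assoc, ← Complex.ofReal_mul,
    bracket_mul_bracket_neg, Complex.ofReal_one, one_mul]

/-- `H^(σ/2)` is the range of the Bessel potential on real-valued `L²` functions. -/
theorem memHs_iff (hσ₀ : 0 ≤ σ) {g : RealL2 N} :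
    MemHs (σ / 2) g ↔ ∃ w, besselOp σ w = g := by
  constructor
  · intro h
    have hang := measurable_angularFreq (N := N)
    obtain ⟨w, hw⟩ := exists_realFourier_eq_mul (fun r => (1 + r ^ 2) ^ (σ / 2 / 2)) g
      ⟨(Measurable.aestronglyMeasurable (by fun_prop)).mul (Lp.aestronglyMeasurable _), h⟩
    refine ⟨w, ext_realFourier ?_⟩
    filter_upwards [realFourier_radialOp (isRadialSymbol_bessel hσ₀) w, hw] with η h1 h2
    rw [besselOp, h1, h2, ← mul_assoc, ← Complex.ofReal_mul, mul_comm (_ ^ _),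
      bracket_mul_bracket_neg, Complex.ofReal_one, one_mul]
  · rintro ⟨w, rfl⟩
    rw [MemHs, sobolevENorm_besselOp hσ₀]
    exact enorm_lt_top

theorem besselOp_injective (hσ₀ : 0 ≤ σ) :
    Function.Injective (besselOp σ : RealL2 N → RealL2 N) := by
  refine (injective_iff_map_eq_zero _).mpr fun w hw => ?_
  have h1 := sobolevENorm_besselOp hσ₀ w
  have h2 := sobolevENorm_besselOp hσ₀ (0 : RealL2 N)
  rw [hw] at h1
  rw [map_zero, enorm_zero] at h2
  rw [h2] at h1
  exact enorm_eq_zero.mp h1.symm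

theorem continuous_radialOp (hN : 0 < N) {m : ℝ → ℝ → ℝ} (hm : ∀ t, IsRadialSymbol (m t))
    (hcont : ∀ r, 0 < r → Continuous fun t => m t r)
    (hbound : ∀ T, ∃ C, ∀ t, |t| ≤ T → ∀ r, 0 < r → |m t r| ≤ C) (g : RealL2 N) :
    Continuous fun t => radialOp (m t) g := by
  refine continuous_iff_continuousAt.mpr fun t₀ => ?_
  obtain ⟨C, hC⟩ := hbound (|t₀| + 1)
  refine tendsto_of_realFourier_eq_mul hN (C := C + C) (fun t => realFourier_radialOp (hm t) g)
    (realFourier_radialOp (hm t₀) g) ?_ fun r hr => (hcont r hr).tendsto t₀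
  have hev : ∀ᶠ t in 𝓝 t₀, |t| < |t₀| + 1 :=
    (continuous_abs.tendsto t₀).eventually (gt_mem_nhds (by linarith))
  filter_upwards [hev] with t ht r hr
  exact (abs_sub _ _).trans (add_le_add (hC t ht.le r hr) (hC t₀ (by linarith) r hr))

theorem continuous_cosOp (hN : 0 < N) (g : RealL2 N) : Continuous fun t => cosOp σ t g :=
  continuous_radialOp hN (isRadialSymbol_cos σ) (fun _ _ => by fun_prop)
    (fun _ => ⟨1, fun _ _ _ _ => Real.abs_cos_le_one _⟩) g

theorem continuous_liftedSinOp (hN : 0 < N) (hσ₀ : 0 ≤ σ) (hσ₂ : σ ≤ 2) (g : RealL2 N) :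
    Continuous fun t => liftedSinOp σ t g :=
  continuous_radialOp hN (isRadialSymbol_liftedSin hσ₀ hσ₂) (fun _ _ => by fun_prop)
    (fun T => ⟨1 + T, fun t ht _ hr =>
      (abs_liftedSin_le hσ₀ hσ₂ t hr.le).trans (by linarith)⟩) g

theorem continuous_derivCosOp (hN : 0 < N) (hσ₀ : 0 ≤ σ) (g : RealL2 N) :
    Continuous fun t => derivCosOp σ t g :=
  continuous_radialOp hN (isRadialSymbol_derivCos hσ₀) (fun _ _ => by fun_prop)
    (fun _ => ⟨1, fun t _ _ hr => abs_derivCos_le hσ₀ t hr.le⟩) g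

/-- A strongly continuous family of operators with locally bounded norms is jointly continuous. -/
theorem continuous_uncurry_of_bound {Y E : Type*} [NormedAddCommGroup Y] [NormedSpace ℝ Y]
    [NormedAddCommGroup E] [NormedSpace ℝ E] {K : ℝ → Y →L[ℝ] E}
    (hK : ∀ y, Continuous fun t => K t y) (hb : ∀ t y, ‖K t y‖ ≤ (1 + |t|) * ‖y‖) :
    Continuous fun q : ℝ × Y => K q.1 q.2 := by
  refine continuous_iff_continuousAt.mpr fun ⟨t₀, y₀⟩ => ?_
  have h1 : Tendsto (fun q : ℝ × Y => K q.1 (q.2 - y₀)) (𝓝 (t₀, y₀)) (𝓝 0) := by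
    refine squeeze_zero_norm (fun q => hb _ _) ?_
    have : Continuous fun q : ℝ × Y => (1 + |q.1|) * ‖q.2 - y₀‖ := by fun_prop
    simpa using this.tendsto (t₀, y₀)
  have h2 : Tendsto (fun q : ℝ × Y => K q.1 y₀) (𝓝 (t₀, y₀)) (𝓝 (K t₀ y₀)) :=
    ((hK y₀).comp continuous_fst).tendsto (t₀, y₀)
  simpa [ContinuousAt] using h1.add h2

theorem realFourier_smul_radialOp_sub {m₁ m₂ : ℝ → ℝ} (h₁ : IsRadialSymbol m₁)
    (h₂ : IsRadialSymbol m₂) (c : ℝ) (g : RealL2 N) :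
    realFourier (c • (radialOp m₁ g - radialOp m₂ g)) =ᵐ[volume] fun η =>
      ((c * (m₁ (angularFreq η) - m₂ (angularFreq η)) : ℝ) : ℂ) * realFourier g η := by
  rw [map_smul, map_sub]
  filter_upwards [realFourier_radialOp h₁ g, realFourier_radialOp h₂ g,
    Lp.coeFn_sub (realFourier (radialOp m₁ g)) (realFourier (radialOp m₂ g)),
    Lp.coeFn_smul c (realFourier (radialOp m₁ g) - realFourier (radialOp m₂ g))]
    with η a1 a2 a3 a4
  rw [a4, Pi.smul_apply, a3, Pi.sub_apply, a1, a2, Complex.real_smul]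
  push_cast
  ring

/-- Strong differentiability of a family of radial multipliers whose symbols are Lipschitz in the
parameter, uniformly in the frequency. -/
theorem hasDerivAt_radialOp (hN : 0 < N) {m m' : ℝ → ℝ → ℝ} (hm : ∀ t, IsRadialSymbol (m t))
    (hm' : ∀ t, IsRadialSymbol (m' t)) {C : ℝ} (hC : ∀ t r, 0 < r → |m' t r| ≤ C)
    (hderiv : ∀ t r, 0 < r → HasDerivAt (fun t => m t r) (m' t r) t) (g : RealL2 N) (t₀ : ℝ) :
    HasDerivAt (fun t => radialOp (m t) g) (radialOp (m' t₀) g) t₀ := by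
  rw [hasDerivAt_iff_tendsto_slope]
  have hlip : ∀ t r, 0 < r → |(t - t₀)⁻¹ * (m t r - m t₀ r)| ≤ C := by
    intro t r hr
    have h := Convex.norm_image_sub_le_of_norm_hasDerivWithin_le (s := univ)
      (fun t _ => (hderiv t r hr).hasDerivWithinAt) (fun t _ => hC t r hr) convex_univ
      (mem_univ t₀) (mem_univ t)
    rw [Real.norm_eq_abs, Real.norm_eq_abs] at h
    rw [abs_mul, abs_inv, inv_mul_eq_div]
    exact div_le_of_le_mul₀ (abs_nonneg _) ((abs_nonneg _).trans (hC t r hr)) h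
  change Tendsto (fun t => (t - t₀)⁻¹ • (radialOp (m t) g - radialOp (m t₀) g)) _ _
  refine tendsto_of_realFourier_eq_mul hN (C := C + C)
    (a := fun t r => (t - t₀)⁻¹ * (m t r - m t₀ r)) (fun t => realFourier_smul_radialOp_sub
    (hm t) (hm t₀) (t - t₀)⁻¹ g) (realFourier_radialOp (hm' t₀) g)
    (Eventually.of_forall fun t r hr => ?_) fun r hr => ?_
  · exact (abs_sub _ _).trans (add_le_add (hlip t r hr) (hC t₀ r hr))
  · exact hasDerivAt_iff_tendsto_slope.mp (hderiv t₀ r hr)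

theorem hasDerivAt_sin_mul_div {a : ℝ} (ha : a ≠ 0) (t : ℝ) :
    HasDerivAt (fun t => Real.sin (t * a) / a) (Real.cos (t * a)) t := by
  have h := (((hasDerivAt_id t).mul_const a).sin).div_const a
  simpa [ha] using h

/-- The formula fails for the symbols at `ξ = 0`, where `sin (t · 0) / 0` is the junk value `0` while
`cos (t · 0) = 1`; this is a null set of frequencies because `N > 0`. -/
theorem hasDerivAt_sinOp (hN : 0 < N) (g : RealL2 N) (t : ℝ) :
    HasDerivAt (fun t => sinOp σ t g) (cosOp σ t g) t :=
  hasDerivAt_radialOp hN (isRadialSymbol_sin σ) (isRadialSymbol_cos σ)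
    (fun _ _ _ => Real.abs_cos_le_one _)
    (fun t _ hr => hasDerivAt_sin_mul_div (Real.rpow_pos_of_pos hr _).ne' t) g t

theorem hasDerivAt_cosOp_besselOp (hN : 0 < N) (hσ₀ : 0 ≤ σ) (w : RealL2 N) (t : ℝ) :
    HasDerivAt (fun t => cosOp σ t (besselOp σ w)) (derivCosOp σ t w) t := by
  have h3 : ∀ t, IsRadialSymbol fun r =>
      (1 + r ^ 2) ^ (-(σ / 2 / 2)) * Real.cos (t * r ^ (σ / 2)) := fun t => by
    refine .of_bound (C := 1) (by fun_prop) fun r _ => ?_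
    rw [abs_mul]
    exact mul_le_one₀ (abs_bracket_neg_le hσ₀ r) (abs_nonneg _) (Real.abs_cos_le_one _)
  have h4 : (fun t => cosOp σ t (besselOp σ w)) = fun t => radialOp
      (fun r => (1 + r ^ 2) ^ (-(σ / 2 / 2)) * Real.cos (t * r ^ (σ / 2))) w := by
    ext1 t
    exact radialOp_radialOp (isRadialSymbol_cos σ t) (isRadialSymbol_bessel hσ₀) (h3 t)
      (fun _ _ => mul_comm _ _) w
  rw [h4]
  refine hasDerivAt_radialOp hN h3 (isRadialSymbol_derivCos hσ₀)
    (fun t r hr => abs_derivCos_le hσ₀ t hr.le) (fun t r _ => ?_) w t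
  have h := (((hasDerivAt_id t).mul_const (r ^ (σ / 2))).cos).const_mul
    ((1 + r ^ 2) ^ (-(σ / 2 / 2)))
  simpa using h

end Propagators

/-! ### The subcritical Sobolev embedding -/

/-- Bernstein's inequality: a function with frequencies below `β` satisfies
`‖h‖_∞ ≤ C β^(N/2) ‖h‖₂`. -/
theorem exists_bernstein (N : ℕ) : ∃ c : ℝ, 0 ≤ c ∧ ∀ (β : ℝ) (h : RealL2 N), 0 < β →
    (∀ᵐ η, β ≤ angularFreq η → realFourier h η = 0) →
    ∀ᵐ x ∂(volume : Measure (EuclideanSpace ℝ (Fin N))), ‖h x‖ ≤ c * β ^ ((N : ℝ) / 2) * ‖h‖ := by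
  set V := EuclideanSpace ℝ (Fin N)
  set v : ℝ := (volume (Metric.ball (0 : V) 1)).toReal with hv
  refine ⟨v ^ (1 / 2 : ℝ), by positivity, fun β h hβ hh => ?_⟩
  set B : Set V := Metric.ball 0 β with hB
  have hBv : volume B = ENNReal.ofReal (β ^ N * v) := by
    rw [hB, Measure.addHaar_ball_of_pos _ _ hβ, finrank_euclideanSpace_fin,
      ENNReal.ofReal_mul (by positivity), hv, ENNReal.ofReal_toReal measure_ball_lt_top.ne]
  have hfin : IsFiniteMeasure (volume.restrict B) := ⟨by
    rw [Measure.restrict_apply_univ, hBv]; exact ENNReal.ofReal_lt_top⟩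
  have hind : (realFourier h : V → ℂ) =ᵐ[volume] B.indicator (realFourier h) := by
    filter_upwards [hh] with η hη
    by_cases hmem : η ∈ B
    · rw [indicator_of_mem hmem]
    · rw [indicator_of_notMem hmem]
      refine hη ?_
      -- `|ξ| = 2π‖η‖ ≥ ‖η‖`, so all frequencies `|ξ| < β` lie in `B`
      simp only [hB, mem_ball_zero_iff, not_lt] at hmem
      unfold angularFreq
      nlinarith [Real.pi_gt_three, norm_nonneg η]
  have h2 : MemLp (realFourier h) 2 (volume.restrict B) := (Lp.memLp _).restrict _
  have hint : IntegrableOn (realFourier h) B volume := h2.integrable (by norm_num)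
  have hint' : Integrable (realFourier h) volume :=
    ((integrable_indicator_iff Metric.isOpen_ball.measurableSet).mpr hint).congr hind.symm
  have hL1 : ∫ η, ‖realFourier h η‖ ≤ v ^ (1 / 2 : ℝ) * β ^ ((N : ℝ) / 2) * ‖h‖ := by
    have e1 : ∫ η, ‖realFourier h η‖ = ∫ η in B, ‖realFourier h η‖ := by
      rw [← integral_indicator Metric.isOpen_ball.measurableSet]
      refine integral_congr_ae ?_
      filter_upwards [hind] with η hη
      by_cases hmem : η ∈ B
      · exact (indicator_of_mem hmem fun η => ‖realFourier h η‖).symm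
      · rw [hη, indicator_of_notMem hmem, norm_zero]
        exact (indicator_of_notMem hmem fun η => ‖realFourier h η‖).symm
    have e2 := eLpNorm_le_eLpNorm_mul_rpow_measure_univ (p := 1) (q := 2)
      (μ := volume.restrict B) (by norm_num) h2.aestronglyMeasurable
    have e3 : eLpNorm (realFourier h) 2 (volume.restrict B) ≤ ENNReal.ofReal ‖h‖ := by
      refine (eLpNorm_mono_measure _ Measure.restrict_le_self).trans_eq ?_
      rw [← realFourier.norm_map h, ofReal_norm, Lp.enorm_def]
    rw [e1, integral_norm_eq_lintegral_enorm h2.aestronglyMeasurable,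
      ← eLpNorm_one_eq_lintegral_enorm]
    refine ENNReal.toReal_le_of_le_ofReal (by positivity) (e2.trans ?_)
    rw [Measure.restrict_apply_univ, hBv,
      ENNReal.ofReal_rpow_of_nonneg (by positivity) (by norm_num)]
    refine (mul_le_mul_left e3 _).trans_eq ?_
    rw [← ENNReal.ofReal_mul (norm_nonneg _)]
    congr 1
    have e4 : (1 / ENNReal.toReal 1 - 1 / ENNReal.toReal 2 : ℝ) = 1 / 2 := by norm_num
    rw [e4, Real.mul_rpow (by positivity) (by positivity), ← Real.rpow_natCast,
      ← Real.rpow_mul hβ.le]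
    ring_nf
  have hbd := ae_norm_le_integral_norm_fourier (complexify h) hint'
  filter_upwards [hbd, coeFn_complexify h] with x h3 h4
  rw [h4, Complex.norm_real] at h3
  exact h3.trans hL1

/-- `‖h‖_{2p} ≤ ‖h‖_∞^(1-1/p) ‖h‖₂^(1/p)`. -/
theorem eLpNorm_le_of_ae_norm_le {N : ℕ} {p : ℝ} (hp : 1 < p) (h : RealL2 N) {D : ℝ} (hD : 0 ≤ D)
    (hh : ∀ᵐ x ∂(volume : Measure (EuclideanSpace ℝ (Fin N))), ‖h x‖ ≤ D * ‖h‖) :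
    eLpNorm h (ENNReal.ofReal (2 * p)) volume ≤ ENNReal.ofReal (D ^ (1 - 1 / p) * ‖h‖) := by
  have hp0 : 0 < p := by linarith
  have hip : 1 / p < 1 := by rw [div_lt_one hp0]; exact hp
  have h1 : ∀ᵐ x ∂(volume : Measure (EuclideanSpace ℝ (Fin N))),
      ‖h x‖ ≤ (D * ‖h‖) ^ (1 - 1 / p) * ‖‖h x‖ ^ (1 / p)‖ := by
    filter_upwards [hh] with x hx
    have e : ‖h x‖ = ‖h x‖ ^ (1 - 1 / p) * ‖h x‖ ^ (1 / p) := by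
      rw [← Real.rpow_add_of_nonneg (norm_nonneg _) (by linarith) (by positivity),
        sub_add_cancel, Real.rpow_one]
    rw [Real.norm_of_nonneg (by positivity : 0 ≤ ‖h x‖ ^ (1 / p))]
    calc ‖h x‖ = _ := e
      _ ≤ _ := by
        gcongr
  refine (eLpNorm_le_mul_eLpNorm_of_ae_le_mul h1 _).trans_eq ?_
  rw [eLpNorm_norm_rpow _ (by positivity), ← ENNReal.ofReal_mul (by positivity)]
  have e1 : 2 * p * (1 / p) = 2 := by field_simp
  rw [e1, ENNReal.ofReal_ofNat, ← Lp.enorm_def, ← ofReal_norm,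
    ENNReal.ofReal_rpow_of_nonneg (norm_nonneg _) (by positivity),
    ← ENNReal.ofReal_mul (by positivity), Real.mul_rpow hD (norm_nonneg _), mul_assoc,
    ← Real.rpow_add_of_nonneg (norm_nonneg _) (by linarith) (by positivity),
    sub_add_cancel, Real.rpow_one]

theorem isRadialSymbol_indicator (s : Set ℝ) (hs : MeasurableSet s) :
    IsRadialSymbol (s.indicator 1) :=
  .of_bound (C := 1) (measurable_one.indicator hs) fun r _ => by
    by_cases h : r ∈ s <;> simp [h]

/-- The subcritical Sobolev embedding `H^(σ/2) ⊂ L^(2p)`, by dyadic decomposition of the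
frequencies: the block `|ξ| ~ 2ᵏ` contributes `2^(k γ) 2^(-k σ/2)` with `γ = N (1 - 1/p) / 2 < σ/2`,
and these terms are summable. -/
theorem exists_sobolev_embedding {N : ℕ} (hN : 0 < N) {σ p : ℝ} (hσ₀ : 0 < σ) (hp : 1 < p)
    (hsub : N * (p - 1) < σ * p) : ∃ C : ℝ, 0 ≤ C ∧ ∀ w : RealL2 N,
      eLpNorm (besselOp σ w) (ENNReal.ofReal (2 * p)) volume ≤ ENNReal.ofReal (C * ‖w‖) := by
  obtain ⟨c, hc, hbern⟩ := exists_bernstein N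
  have hp0 : 0 < p := by linarith
  have hip : 1 / p < 1 := by rw [div_lt_one hp0]; exact hp
  set γ : ℝ := (N : ℝ) / 2 * (1 - 1 / p) with hγ
  have hγσ : γ < σ / 2 := by
    have : γ = N * (p - 1) / (2 * p) := by rw [hγ]; field_simp
    rw [this, div_lt_div_iff₀ (by positivity) (by norm_num)]
    linarith
  have hblock : ∀ (β : ℝ) (h : RealL2 N), 0 < β →
      (∀ᵐ η, β ≤ angularFreq η → realFourier h η = 0) →
      eLpNorm h (ENNReal.ofReal (2 * p)) volume ≤
        ENNReal.ofReal (c ^ (1 - 1 / p) * β ^ γ * ‖h‖) := by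
    intro β h hβ hh
    refine (eLpNorm_le_of_ae_norm_le hp h (by positivity) (hbern β h hβ hh)).trans_eq ?_
    rw [Real.mul_rpow hc (by positivity), ← Real.rpow_mul hβ.le]
  let low : ℕ → RealL2 N → RealL2 N := fun n => radialOp ((Iio ((2 : ℝ) ^ n)).indicator 1)
  let band : ℕ → RealL2 N → RealL2 N :=
    fun n => radialOp ((Ico ((2 : ℝ) ^ n) (2 ^ (n + 1))).indicator 1)
  have hlow : ∀ n g, realFourier (low n g) =ᵐ[volume] fun η =>
      (((Iio ((2 : ℝ) ^ n)).indicator 1 (angularFreq η) : ℝ) : ℂ) * realFourier g η := fun n g =>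
    realFourier_radialOp (isRadialSymbol_indicator _ measurableSet_Iio) g
  have hband : ∀ n g, realFourier (band n g) =ᵐ[volume] fun η =>
      (((Ico ((2 : ℝ) ^ n) (2 ^ (n + 1))).indicator 1 (angularFreq η) : ℝ) : ℂ) *
        realFourier g η := fun n g =>
    realFourier_radialOp (isRadialSymbol_indicator _ measurableSet_Ico) g
  have hsplit : ∀ n g, low (n + 1) g = low n g + band n g := by
    intro n g
    refine ext_realFourier ?_
    rw [map_add]
    filter_upwards [hlow (n + 1) g, hlow n g, hband n g,
      Lp.coeFn_add (realFourier (low n g)) (realFourier (band n g))] with η h1 h2 h3 h4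
    rw [h4, Pi.add_apply, h1, h2, h3, ← add_mul, ← Complex.ofReal_add]
    congr 2
    have hmono : (2 : ℝ) ^ n ≤ 2 ^ (n + 1) := pow_le_pow_right₀ (by norm_num) (Nat.le_succ n)
    rcases lt_or_ge (angularFreq η) (2 ^ n) with h | h
    · simp [h, h.trans_le hmono, not_le.mpr h]
    · simp [h, not_lt.mpr h, indicator, mem_Ico]
  have hbandn : ∀ n w, ‖band n (besselOp σ w)‖ ≤ ((2 : ℝ) ^ n) ^ (-(σ / 2)) * ‖w‖ := by
    intro n w
    refine norm_le_of_realFourier_eq_mul (g := w)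
      (m := fun r => (Ico ((2 : ℝ) ^ n) (2 ^ (n + 1))).indicator 1 r *
        (1 + r ^ 2) ^ (-(σ / 2 / 2))) (Eventually.of_forall fun η _ => ?_) ?_
    · by_cases h : angularFreq η ∈ Ico ((2 : ℝ) ^ n) (2 ^ (n + 1))
      · have h2 : (0 : ℝ) < 2 ^ n := by positivity
        rw [indicator_of_mem h, Pi.one_apply, one_mul, abs_of_nonneg (by positivity)]
        have h3 := (Real.rpow_le_rpow h2.le h.1 (by positivity : (0 : ℝ) ≤ σ / 2)).trans
          (rpow_le_bracket hσ₀.le (angularFreq_nonneg η))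
        rw [Real.rpow_neg (by positivity), Real.rpow_neg (by positivity)]
        exact inv_anti₀ (by positivity) h3
      · rw [indicator_of_notMem h, zero_mul, abs_zero]
        positivity
    · filter_upwards [hband n (besselOp σ w),
        realFourier_radialOp (isRadialSymbol_bessel hσ₀.le) w] with η h1 h2
      rw [h1, besselOp, h2]
      push_cast
      ring
  have hlown : ∀ w, ‖low 0 (besselOp σ w)‖ ≤ ‖w‖ := by
    intro w
    have h1 : ‖low 0 (besselOp σ w)‖ ≤ 1 * ‖besselOp σ w‖ :=
      norm_radialOp_le (measurable_one.indicator measurableSet_Iio) (fun r _ => by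
        by_cases h : r ∈ Iio ((2 : ℝ) ^ 0)
        · rw [indicator_of_mem h]; simp
        · rw [indicator_of_notMem h]; simp) _
    have h2 : ‖besselOp σ w‖ ≤ 1 * ‖w‖ :=
      norm_radialOp_le (by fun_prop) (fun r _ => abs_bracket_neg_le hσ₀.le r) w
    linarith
  set θ : ℝ := 2 ^ (γ - σ / 2) with hθ
  have hθ₀ : 0 ≤ θ := by positivity
  have hθ₁ : θ < 1 := Real.rpow_lt_one_of_one_lt_of_neg (by norm_num) (by linarith)
  set A : ℝ := c ^ (1 - 1 / p) * 2 ^ γ with hA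
  have hA₀ : 0 ≤ A := by positivity
  have hγ₀ : 0 ≤ γ := mul_nonneg (by positivity) (by linarith)
  have hsum : ∀ w n, eLpNorm (low n (besselOp σ w)) (ENNReal.ofReal (2 * p)) volume ≤
      ENNReal.ofReal ((A + ∑ k ∈ Finset.range n, A * θ ^ k) * ‖w‖) := by
    intro w n
    induction n with
    | zero =>
      refine (hblock 1 _ one_pos ?_).trans (ENNReal.ofReal_le_ofReal ?_)
      · filter_upwards [hlow 0 (besselOp σ w)] with η h1 h2
        rw [h1, indicator_of_notMem (by simpa using h2)]
        simp
      · have h2 : (1 : ℝ) ≤ 2 ^ γ := Real.one_le_rpow (by norm_num) hγ₀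
        have h3 := hlown w
        have h4 : 0 ≤ c ^ (1 - 1 / p) := by positivity
        rw [Real.one_rpow, mul_one, Finset.sum_range_zero, add_zero, hA]
        exact mul_le_mul (le_mul_of_one_le_right h4 h2) h3 (norm_nonneg _) (by positivity)
    | succ n ih =>
      rw [hsplit, Finset.sum_range_succ, ← add_assoc, add_mul, ENNReal.ofReal_add (by positivity)
        (by positivity)]
      rw [eLpNorm_congr_ae (Lp.coeFn_add _ _)]
      refine (eLpNorm_add_le (Lp.aestronglyMeasurable _) (Lp.aestronglyMeasurable _)
        (by rw [ENNReal.one_le_ofReal]; linarith)).trans (add_le_add ih ?_)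
      refine (hblock (2 ^ (n + 1)) _ (by positivity) ?_).trans (ENNReal.ofReal_le_ofReal ?_)
      · filter_upwards [hband n (besselOp σ w)] with η h1 h2
        rw [h1, indicator_of_notMem (fun h => not_lt.mpr h2 h.2)]
        simp
      · have e : ((2 : ℝ) ^ (n + 1)) ^ γ * ((2 : ℝ) ^ n) ^ (-(σ / 2)) = 2 ^ γ * θ ^ n := by
          rw [hθ, ← Real.rpow_natCast, ← Real.rpow_natCast, ← Real.rpow_natCast,
            ← Real.rpow_mul (by norm_num), ← Real.rpow_mul (by norm_num),
            ← Real.rpow_mul (by norm_num), ← Real.rpow_add (by norm_num),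
            ← Real.rpow_add (by norm_num)]
          congr 1
          push_cast
          ring
        calc c ^ (1 - 1 / p) * ((2 : ℝ) ^ (n + 1)) ^ γ * ‖band n (besselOp σ w)‖
            ≤ c ^ (1 - 1 / p) * ((2 : ℝ) ^ (n + 1)) ^ γ * (((2 : ℝ) ^ n) ^ (-(σ / 2)) * ‖w‖) :=
              mul_le_mul_of_nonneg_left (hbandn n w) (by positivity)
          _ = c ^ (1 - 1 / p) * (((2 : ℝ) ^ (n + 1)) ^ γ * ((2 : ℝ) ^ n) ^ (-(σ / 2))) * ‖w‖ := by
              ring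
          _ = A * θ ^ n * ‖w‖ := by rw [e, hA]; ring
  refine ⟨A + A * (1 - θ)⁻¹, by have := inv_nonneg.mpr (sub_nonneg.mpr hθ₁.le); positivity,
    fun w => ?_⟩
  have hlim : Tendsto (fun n => low n (besselOp σ w)) atTop (𝓝 (besselOp σ w)) := by
    refine tendsto_of_realFourier_eq_mul hN (C := 1) (a₀ := fun _ => 1)
      (fun n => hlow n (besselOp σ w)) (Eventually.of_forall fun η => by simp)
      (Eventually.of_forall fun n r _ => ?_) fun r _ => ?_
    · by_cases h : r ∈ Iio ((2 : ℝ) ^ n)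
      · rw [indicator_of_mem h]; simp
      · rw [indicator_of_notMem h]; simp
    · refine tendsto_const_nhds.congr' ?_
      have hpow := tendsto_pow_atTop_atTop_of_one_lt (one_lt_two (α := ℝ))
      filter_upwards [hpow.eventually_gt_atTop r] with n hn
      rw [indicator_of_mem (mem_Iio.mpr hn), Pi.one_apply]
  refine eLpNorm_le_of_tendstoInMeasure (Eventually.of_forall fun n => ?_)
    (tendstoInMeasure_of_tendsto_Lp hlim) fun n => Lp.aestronglyMeasurable _
  refine (hsum w n).trans (ENNReal.ofReal_le_ofReal (mul_le_mul_of_nonneg_right ?_ (norm_nonneg _)))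
  rw [← Finset.mul_sum]
  have := (summable_geometric_of_lt_one hθ₀ hθ₁).sum_le_tsum (Finset.range n)
    (fun k _ => by positivity)
  rw [tsum_geometric_of_lt_one hθ₀ hθ₁] at this
  gcongr

/-! ### The nonlinearity -/

/-- The growth condition of the nonlinearity with exponent `p`. -/
def HasPowerGrowth (f : ℝ → ℝ) (p C₀ : ℝ) : Prop :=
  ∀ z w : ℝ, |f z - f w| ≤ C₀ * (|z| ^ (p - 1) + |w| ^ (p - 1)) * |z - w|

theorem HasPowerGrowth.continuous {f : ℝ → ℝ} {p C₀ : ℝ} (hf : HasPowerGrowth f p C₀)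
    (hp : 1 < p) : Continuous f := by
  refine continuous_iff_continuousAt.mpr fun w => ?_
  have hc : Continuous fun z : ℝ => C₀ * (|z| ^ (p - 1) + |w| ^ (p - 1)) * |z - w| := by
    have : Continuous fun z : ℝ => |z| ^ (p - 1) :=
      continuous_abs.rpow_const fun _ => Or.inr (by linarith)
    fun_prop
  have h0 : Tendsto (fun z : ℝ => C₀ * (|z| ^ (p - 1) + |w| ^ (p - 1)) * |z - w|) (𝓝 w) (𝓝 0) := by
    simpa using hc.tendsto w
  exact tendsto_iff_norm_sub_tendsto_zero.mpr (squeeze_zero (fun _ => norm_nonneg _)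
    (fun z => hf z w) h0)

/-- Hölder's inequality for the difference `f(u) - f(v)`. -/
theorem eLpNorm_comp_sub_comp_le {α : Type*} [MeasurableSpace α] {μ : Measure α} {f : ℝ → ℝ}
    {p C₀ : ℝ} (hf : HasPowerGrowth f p C₀) (hp : 1 < p) {u v : α → ℝ}
    (hu : AEStronglyMeasurable u μ) (hv : AEStronglyMeasurable v μ) :
    eLpNorm (fun x => f (u x) - f (v x)) 2 μ ≤ ENNReal.ofReal C₀ *
      ((eLpNorm u (ENNReal.ofReal (2 * p)) μ ^ (p - 1) +
        eLpNorm v (ENNReal.ofReal (2 * p)) μ ^ (p - 1)) *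
        eLpNorm (fun x => u x - v x) (ENNReal.ofReal (2 * p)) μ) := by
  have hp1 : 0 < p - 1 := by linarith
  have hp0 : 0 < p := by linarith
  set q : ℝ := 2 * p / (p - 1) with hq
  have hq1 : 1 ≤ q := by rw [hq, one_le_div hp1]; linarith
  have htriple : ENNReal.HolderTriple (ENNReal.ofReal q) (ENNReal.ofReal (2 * p)) 2 := ⟨by
    rw [← ENNReal.ofReal_inv_of_pos (by linarith), ← ENNReal.ofReal_inv_of_pos (by linarith),
      ← ENNReal.ofReal_add (by positivity) (by positivity), ← ENNReal.ofReal_ofNat,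
      ← ENNReal.ofReal_inv_of_pos (by norm_num), hq]
    congr 1
    field_simp
    ring⟩
  have hmeas : ∀ {w : α → ℝ}, AEStronglyMeasurable w μ →
      AEStronglyMeasurable (fun x => ‖w x‖ ^ (p - 1)) μ := fun hw =>
    (continuous_norm.rpow_const fun _ => Or.inr hp1.le).comp_aestronglyMeasurable hw
  have hpow : ∀ w : α → ℝ, eLpNorm (fun x => ‖w x‖ ^ (p - 1)) (ENNReal.ofReal q) μ =
      eLpNorm w (ENNReal.ofReal (2 * p)) μ ^ (p - 1) := fun w => by
    rw [eLpNorm_norm_rpow _ hp1, ← ENNReal.ofReal_mul (by linarith), hq,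
      div_mul_cancel₀ _ hp1.ne']
  have h1 : ∀ᵐ x ∂μ, ‖f (u x) - f (v x)‖ ≤
      C₀ * ‖(‖u x‖ ^ (p - 1) + ‖v x‖ ^ (p - 1)) • (u x - v x)‖ := Eventually.of_forall fun x => by
    rw [norm_smul, Real.norm_of_nonneg (by positivity : 0 ≤ ‖u x‖ ^ (p - 1) + ‖v x‖ ^ (p - 1)),
      ← mul_assoc]
    exact hf _ _
  refine (eLpNorm_le_mul_eLpNorm_of_ae_le_mul h1 2).trans ?_
  gcongr
  refine (eLpNorm_smul_le_mul_eLpNorm (p := ENNReal.ofReal q) (q := ENNReal.ofReal (2 * p))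
    (hu.sub hv) ((hmeas hu).add (hmeas hv))).trans ?_
  refine mul_le_mul_left ?_ _
  refine (eLpNorm_add_le (hmeas hu) (hmeas hv) (by rwa [ENNReal.one_le_ofReal])).trans_eq ?_
  rw [hpow, hpow]

open Classical in
/-- The map `w ↦ f(⟨∇⟩^(-σ/2) w)` on `L²`; it takes the value `0` where `f(⟨∇⟩^(-σ/2) w) ∉ L²`. -/
noncomputable def nemytskii {N : ℕ} (σ : ℝ) (f : ℝ → ℝ) (w : RealL2 N) : RealL2 N :=
  if h : MemLp (fun x => f (besselOp σ w x)) 2 volume then h.toLp _ else 0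

section Nemytskii

variable {N : ℕ} {σ p : ℝ} {f : ℝ → ℝ}

/-- In the subcritical range the nonlinearity maps `H^(σ/2)` into `L²`, and is Lipschitz there on
bounded sets. -/
theorem nemytskii_spec (hN : 0 < N) (hσ₀ : 0 < σ) (hp : 1 < p) (hsub : N * (p - 1) < σ * p)
    (hf₀ : f 0 = 0) {C₀ : ℝ} (hC₀ : 0 ≤ C₀) (hf : HasPowerGrowth f p C₀) :
    (∀ w : RealL2 N, nemytskii σ f w =ᵐ[volume] fun x => f (besselOp σ w x)) ∧
    ∀ R, ∃ L, 0 ≤ L ∧ ∀ w z : RealL2 N, ‖w‖ ≤ R → ‖z‖ ≤ R →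
      ‖nemytskii σ f w - nemytskii σ f z‖ ≤ L * ‖w - z‖ := by
  obtain ⟨C, hC, hemb⟩ := exists_sobolev_embedding hN hσ₀ hp hsub
  have hfc := hf.continuous hp
  have hp1 : 0 < p - 1 := by linarith
  have hmem : ∀ w : RealL2 N, MemLp (fun x => f (besselOp σ w x)) 2 volume := by
    intro w
    refine ⟨hfc.comp_aestronglyMeasurable (Lp.aestronglyMeasurable _), ?_⟩
    have h := eLpNorm_comp_sub_comp_le (μ := volume) (v := fun _ => 0) hf hp
      (Lp.aestronglyMeasurable (besselOp σ w)) aestronglyMeasurable_const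
    simp only [hf₀, sub_zero] at h
    refine h.trans_lt ?_
    have hlt : eLpNorm (besselOp σ w) (ENNReal.ofReal (2 * p)) volume < ∞ :=
      (hemb w).trans_lt ENNReal.ofReal_lt_top
    refine ENNReal.mul_lt_top ENNReal.ofReal_lt_top (ENNReal.mul_lt_top ?_ hlt)
    refine ENNReal.add_lt_top.mpr ⟨ENNReal.rpow_lt_top_of_nonneg hp1.le hlt.ne, ?_⟩
    simp [hp1]
  have hspec : ∀ w : RealL2 N, nemytskii σ f w =ᵐ[volume] fun x => f (besselOp σ w x) := by
    intro w
    rw [nemytskii, dif_pos (hmem w)]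
    exact (hmem w).coeFn_toLp
  refine ⟨hspec, fun R => ?_⟩
  rcases lt_or_ge R 0 with hR | hR
  · exact ⟨0, le_rfl, fun w _ hw => absurd ((norm_nonneg w).trans hw) (not_le.mpr hR)⟩
  refine ⟨C₀ * (((C * R) ^ (p - 1) + (C * R) ^ (p - 1)) * C), by positivity, fun w z hw hz => ?_⟩
  have h := eLpNorm_comp_sub_comp_le (μ := volume) hf hp
    (Lp.aestronglyMeasurable (besselOp σ w)) (Lp.aestronglyMeasurable (besselOp σ z))
  have hb : ∀ y : RealL2 N, ‖y‖ ≤ R →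
      eLpNorm (besselOp σ y) (ENNReal.ofReal (2 * p)) volume ^ (p - 1) ≤
        ENNReal.ofReal ((C * R) ^ (p - 1)) := fun y hy => by
    rw [← ENNReal.ofReal_rpow_of_nonneg (by positivity) hp1.le]
    exact ENNReal.rpow_le_rpow ((hemb y).trans (ENNReal.ofReal_le_ofReal (by gcongr))) hp1.le
  have hd : eLpNorm (fun x => besselOp σ w x - besselOp σ z x) (ENNReal.ofReal (2 * p)) volume ≤
      ENNReal.ofReal (C * ‖w - z‖) := by
    refine le_trans (le_of_eq ?_) (hemb (w - z))
    rw [map_sub]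
    exact (eLpNorm_congr_ae (Lp.coeFn_sub _ _)).symm
  have heq : eLpNorm (fun x => f (besselOp σ w x) - f (besselOp σ z x)) 2 volume =
      ENNReal.ofReal ‖nemytskii σ f w - nemytskii σ f z‖ := by
    rw [ofReal_norm, Lp.enorm_def]
    refine eLpNorm_congr_ae ?_
    filter_upwards [hspec w, hspec z, Lp.coeFn_sub (nemytskii σ f w) (nemytskii σ f z)]
      with x h1 h2 h3
    rw [h3, Pi.sub_apply, h1, h2]
  rw [heq] at h
  have h2 : ENNReal.ofReal ‖nemytskii σ f w - nemytskii σ f z‖ ≤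
      ENNReal.ofReal (C₀ * (((C * R) ^ (p - 1) + (C * R) ^ (p - 1)) * (C * ‖w - z‖))) := by
    refine h.trans ?_
    rw [ENNReal.ofReal_mul hC₀,
      ENNReal.ofReal_mul (by positivity : 0 ≤ (C * R) ^ (p - 1) + (C * R) ^ (p - 1)),
      ENNReal.ofReal_add (by positivity) (by positivity)]
    gcongr
    · exact hb w hw
    · exact hb z hz
  refine ((ENNReal.ofReal_le_ofReal_iff (by positivity)).mp h2).trans_eq ?_
  ring

end Nemytskii

/-! ### Duhamel integrals and Volterra equations -/

section Volterra

variable {Y E : Type*} [NormedAddCommGroup Y] [NormedSpace ℝ Y]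
  [NormedAddCommGroup E] [NormedSpace ℝ E]

theorem aestronglyMeasurable_kernel {K : ℝ → Y →L[ℝ] E}
    (hK : Continuous fun q : ℝ × Y => K q.1 q.2) {G : ℝ → Y} {μ : Measure ℝ}
    (hG : AEStronglyMeasurable G μ) (t : ℝ) :
    AEStronglyMeasurable (fun τ => K (t - τ) (G τ)) μ :=
  hK.comp_aestronglyMeasurable
    ((continuous_const.sub continuous_id).aestronglyMeasurable.prodMk hG)

theorem norm_kernel_le {K : ℝ → Y →L[ℝ] E} (hKb : ∀ t y, ‖K t y‖ ≤ (1 + |t|) * ‖y‖)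
    {t τ : ℝ} (hτ : τ ∈ Ioc (0 : ℝ) t) (ht : t ≤ 1) (y : Y) : ‖K (t - τ) y‖ ≤ 2 * ‖y‖ := by
  refine (hKb _ _).trans (mul_le_mul_of_nonneg_right ?_ (norm_nonneg _))
  rw [abs_of_nonneg (by linarith [hτ.2])]
  linarith [hτ.1]

theorem intervalIntegrable_kernel {K : ℝ → Y →L[ℝ] E}
    (hK : Continuous fun q : ℝ × Y => K q.1 q.2) (hKb : ∀ t y, ‖K t y‖ ≤ (1 + |t|) * ‖y‖)
    {G : ℝ → Y} {t B : ℝ} (ht₀ : 0 ≤ t) (ht₁ : t ≤ 1)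
    (hG : AEStronglyMeasurable G (volume.restrict (Ioc 0 t))) (hB : ∀ τ ∈ Ioc 0 t, ‖G τ‖ ≤ B) :
    IntervalIntegrable (fun τ => K (t - τ) (G τ)) volume 0 t := by
  rw [intervalIntegrable_iff_integrableOn_Ioc_of_le ht₀]
  refine Integrable.of_bound (aestronglyMeasurable_kernel hK hG t) (2 * B) ?_
  filter_upwards [ae_restrict_mem measurableSet_Ioc] with τ hτ
  exact (norm_kernel_le hKb hτ ht₁ _).trans (by linarith [hB τ hτ])

/-- The Duhamel integral `∫₀ᵗ K(t-τ) G(τ) dτ`, `0 ≤ t ≤ 1`, as an integral over the fixed interval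
`(0,1]`; it vanishes for `t ≤ 0`. -/
noncomputable def duhamel (K : ℝ → Y →L[ℝ] E) (G : ℝ → Y) (t : ℝ) : E :=
  ∫ τ in Ioc (0 : ℝ) 1, (Iic t).indicator (fun τ => K (t - τ) (G τ)) τ

theorem duhamel_eq (K : ℝ → Y →L[ℝ] E) (G : ℝ → Y) {t : ℝ} (ht₀ : 0 ≤ t) (ht₁ : t ≤ 1) :
    duhamel K G t = ∫ τ in (0 : ℝ)..t, K (t - τ) (G τ) := by
  rw [duhamel, setIntegral_indicator measurableSet_Iic, intervalIntegral.integral_of_le ht₀]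
  congr 2
  ext τ
  simp only [mem_inter_iff, mem_Ioc, mem_Iic]
  constructor
  · rintro ⟨⟨h1, _⟩, h3⟩; exact ⟨h1, h3⟩
  · rintro ⟨h1, h2⟩; exact ⟨⟨h1, h2.trans ht₁⟩, h2⟩

theorem continuous_duhamel {K : ℝ → Y →L[ℝ] E}
    (hK : Continuous fun q : ℝ × Y => K q.1 q.2) (hKb : ∀ t y, ‖K t y‖ ≤ (1 + |t|) * ‖y‖)
    {G : ℝ → Y} {B : ℝ} (hG : AEStronglyMeasurable G (volume.restrict (Ioc 0 1)))
    (hB : ∀ τ ∈ Ioc (0 : ℝ) 1, ‖G τ‖ ≤ B) : Continuous (duhamel K G) := by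
  refine continuous_iff_continuousAt.mpr fun t₀ => ?_
  refine continuousAt_of_dominated (bound := fun _ => (|t₀| + 3) * B)
    (Eventually.of_forall fun t =>
      (aestronglyMeasurable_kernel hK hG t).indicator measurableSet_Iic) ?_ (integrable_const _) ?_
  · have hev : ∀ᶠ t in 𝓝 t₀, |t| < |t₀| + 1 :=
      (continuous_abs.tendsto t₀).eventually (gt_mem_nhds (by linarith))
    filter_upwards [hev] with t ht
    filter_upwards [ae_restrict_mem measurableSet_Ioc] with τ hτ
    refine (norm_indicator_le_norm_self _ _).trans ((hKb _ _).trans ?_)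
    have h1 : |t - τ| ≤ |t| + 1 := (abs_sub _ _).trans (by
      rw [abs_of_pos hτ.1]; linarith [hτ.2])
    have h2 := hB τ hτ
    have h3 := norm_nonneg (G τ)
    have h4 := abs_nonneg t₀
    exact mul_le_mul (by linarith) h2 h3 (by linarith)
  · have hne : ∀ᵐ τ ∂(volume.restrict (Ioc (0 : ℝ) 1)), τ ≠ t₀ :=
      ae_restrict_of_ae (by simp [ae_iff])
    filter_upwards [hne] with τ hτ
    have hc : Continuous fun t => K (t - τ) (G τ) :=
      hK.comp ((continuous_id.sub continuous_const).prodMk continuous_const)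
    rcases lt_or_gt_of_ne hτ with h | h
    · refine hc.continuousAt.congr ?_
      filter_upwards [lt_mem_nhds h] with t ht
      rw [indicator_of_mem (mem_Iic.mpr ht.le)]
    · refine (continuousAt_const (y := (0 : E))).congr ?_
      filter_upwards [gt_mem_nhds h] with t ht
      rw [indicator_of_notMem (by simpa using ht)]

/-- If `S` is strongly differentiable with derivative `C` and `S 0 = 0`, then
`d/dt ∫₀ᵗ S(t-τ) G(τ) dτ = ∫₀ᵗ C(t-τ) G(τ) dτ` for every bounded measurable `G`. No continuity of
`G` is needed, since `t ↦ S((t-τ)₊) G(τ)` is Lipschitz and is differentiable off `t = τ`. -/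
theorem hasDerivAt_duhamel {S C : ℝ → Y →L[ℝ] E}
    (hS : Continuous fun q : ℝ × Y => S q.1 q.2) (hC : Continuous fun q : ℝ × Y => C q.1 q.2)
    (hSC : ∀ y t, HasDerivAt (fun t => S t y) (C t y) t) (hS₀ : ∀ y, S 0 y = 0)
    (hCb : ∀ t y, ‖C t y‖ ≤ ‖y‖) {G : ℝ → Y} {B : ℝ}
    (hG : AEStronglyMeasurable G (volume.restrict (Ioc 0 1)))
    (hB : ∀ τ ∈ Ioc (0 : ℝ) 1, ‖G τ‖ ≤ B) (t₀ : ℝ) :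
    HasDerivAt (duhamel S G) (duhamel C G t₀) t₀ := by
  have hlip : ∀ r r' y, ‖S r y - S r' y‖ ≤ ‖y‖ * |r - r'| := fun r r' y =>
    Convex.norm_image_sub_le_of_norm_hasDerivWithin_le (s := univ)
      (fun t _ => (hSC y t).hasDerivWithinAt) (fun t _ => hCb t y) convex_univ
      (mem_univ r') (mem_univ r)
  have hmax : ∀ t τ, (Iic t).indicator (fun τ => S (t - τ) (G τ)) τ = S (max (t - τ) 0) (G τ) := by
    intro t τ
    by_cases h : τ ≤ t
    · rw [indicator_of_mem (mem_Iic.mpr h), max_eq_left (by linarith)]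
    · rw [indicator_of_notMem (by simpa using h), max_eq_right (by linarith), hS₀]
  have hmeas : ∀ t, AEStronglyMeasurable (fun τ => (Iic t).indicator (fun τ => S (t - τ) (G τ)) τ)
      (volume.restrict (Ioc (0 : ℝ) 1)) := fun t =>
    (aestronglyMeasurable_kernel hS hG t).indicator measurableSet_Iic
  refine (hasDerivAt_integral_of_dominated_loc_of_lip (bound := fun _ => |B|) univ_mem
    (Eventually.of_forall hmeas) ?_
    ((aestronglyMeasurable_kernel hC hG t₀).indicator measurableSet_Iic) ?_
    (integrable_const _) ?_).2
  · refine Integrable.of_bound (hmeas t₀) (B * (|t₀| + 1)) ?_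
    filter_upwards [ae_restrict_mem measurableSet_Ioc] with τ hτ
    rw [hmax, ← sub_zero (S _ _), ← hS₀ (G τ)]
    refine (hlip _ _ _).trans ?_
    have h1 : |max (t₀ - τ) 0 - 0| ≤ |t₀| + 1 := by
      rw [sub_zero, abs_of_nonneg (le_max_right _ _)]
      exact max_le (by linarith [le_abs_self t₀, hτ.1]) (by positivity)
    exact mul_le_mul (hB τ hτ) h1 (abs_nonneg _) ((norm_nonneg _).trans (hB τ hτ))
  · filter_upwards [ae_restrict_mem measurableSet_Ioc] with τ hτ
    refine LipschitzOnWith.of_dist_le_mul fun t _ t' _ => ?_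
    simp only [hmax, dist_eq_norm, Real.coe_nnabs, abs_abs]
    refine (hlip _ _ _).trans ?_
    have h1 : |max (t - τ) 0 - max (t' - τ) 0| ≤ |t - t'| := by
      refine (abs_max_sub_max_le_abs _ _ _).trans_eq ?_
      congr 1; ring
    exact mul_le_mul ((hB τ hτ).trans (le_abs_self _)) h1 (abs_nonneg _) (abs_nonneg _)
  · have hne : ∀ᵐ τ ∂(volume.restrict (Ioc (0 : ℝ) 1)), τ ≠ t₀ :=
      ae_restrict_of_ae (by simp [ae_iff])
    filter_upwards [hne] with τ hτ
    rcases lt_or_gt_of_ne hτ with h | h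
    · rw [indicator_of_mem (mem_Iic.mpr h.le)]
      have h1 : HasDerivAt (fun t => S (t - τ) (G τ)) (C (t₀ - τ) (G τ)) t₀ :=
        HasDerivAt.comp_sub_const t₀ τ (hSC (G τ) (t₀ - τ))
      refine h1.congr_of_eventuallyEq ?_
      filter_upwards [lt_mem_nhds h] with t ht
      rw [indicator_of_mem (mem_Iic.mpr ht.le)]
    · rw [indicator_of_notMem (by simpa using h)]
      refine (hasDerivAt_const t₀ (0 : E)).congr_of_eventuallyEq ?_
      filter_upwards [gt_mem_nhds h] with t ht
      rw [indicator_of_notMem (by simpa using ht)]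

/-- A map that vanishes at `0` and is Lipschitz on balls is bounded on balls. -/
theorem exists_bound_on_ball {X Z : Type*} [NormedAddCommGroup X] [NormedAddCommGroup Z]
    {φ : ℝ → X → Z} (hφ₀ : ∀ τ, φ τ 0 = 0)
    (hφ : ∀ R, ∃ L, 0 ≤ L ∧ ∀ τ x y, ‖x‖ ≤ R → ‖y‖ ≤ R → ‖φ τ x - φ τ y‖ ≤ L * ‖x - y‖) (R : ℝ) :
    ∃ M, ∀ τ x, ‖x‖ ≤ R → ‖φ τ x‖ ≤ M := by
  obtain ⟨L, hL₀, hL⟩ := hφ R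
  refine ⟨L * R, fun τ x hx => ?_⟩
  have h := hL τ x 0 hx (by simpa using (norm_nonneg x).trans hx)
  rw [hφ₀, sub_zero, sub_zero] at h
  exact h.trans (by gcongr)

/-- Local existence for `x(t) = a(t) + ∫₀ᵗ K(t-τ) g(τ, x(τ)) dτ` with `g` locally Lipschitz in `x`,
uniformly in `τ`: a contraction on a ball of `C([0,T]; E)` for small `T`. -/
theorem exists_volterra_solution [CompleteSpace E] {K : ℝ → Y →L[ℝ] E}
    (hK : Continuous fun q : ℝ × Y => K q.1 q.2) (hKb : ∀ t y, ‖K t y‖ ≤ (1 + |t|) * ‖y‖)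
    {a : ℝ → E} (ha : Continuous a) {g : ℝ → E → Y} (hg₀ : ∀ τ, g τ 0 = 0)
    (hgL : ∀ R, ∃ L, 0 ≤ L ∧ ∀ τ x y, ‖x‖ ≤ R → ‖y‖ ≤ R → ‖g τ x - g τ y‖ ≤ L * ‖x - y‖)
    (hgm : ∀ (x : ℝ → E) (s : Set ℝ), AEStronglyMeasurable x (volume.restrict s) →
      AEStronglyMeasurable (fun τ => g τ (x τ)) (volume.restrict s)) :
    ∃ T, 0 < T ∧ T ≤ 1 ∧ ∃ x : ℝ → E, Continuous x ∧ (∃ R, ∀ t, ‖x t‖ ≤ R) ∧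
      ∀ t ∈ Icc 0 T, x t = a t + ∫ τ in (0 : ℝ)..t, K (t - τ) (g τ (x τ)) := by
  have hgb := exists_bound_on_ball hg₀ hgL
  obtain ⟨A, hA⟩ := (isCompact_Icc (a := (0 : ℝ)) (b := 1)).exists_bound_of_continuousOn
    ha.continuousOn
  have hA₀ : 0 ≤ A := (norm_nonneg _).trans (hA 0 (by simp))
  set R := A + 1 with hR
  have hR₁ : 1 ≤ R := by linarith
  obtain ⟨L, hL₀, hL⟩ := hgL R
  -- `T` makes the contraction factor `2LT` and the Duhamel term `2LRT` at most `1/2`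
  set T : ℝ := 1 / (4 * (L + 1) * R) with hT
  have hden : 1 ≤ 4 * (L + 1) * R := by nlinarith
  have hT₀ : 0 < T := by positivity
  have hT₁ : T ≤ 1 := by rw [hT]; exact div_le_one_of_le₀ hden (by positivity)
  have hLT : 2 * L * R * T ≤ 1 / 2 := by
    rw [hT, mul_one_div, div_le_div_iff₀ (by positivity) (by norm_num)]
    nlinarith
  have hLT' : 2 * L * T ≤ 1 / 2 := le_trans (by nlinarith [mul_nonneg hL₀ hT₀.le]) hLT
  -- extension of a path on `[0,T]` to the whole line by constants
  let ext : C(Icc (0 : ℝ) T, E) → ℝ → E := fun x t => x (projIcc 0 T hT₀.le t)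
  have hext : ∀ x, Continuous (ext x) := fun x => x.continuous.comp continuous_projIcc
  have hextb : ∀ x t, ‖ext x t‖ ≤ ‖x‖ := fun x t => x.norm_coe_le_norm _
  have hmeas : ∀ x s, AEStronglyMeasurable (fun τ => g τ (ext x τ)) (volume.restrict s) :=
    fun x s => hgm _ s (hext x).aestronglyMeasurable
  have hcont : ∀ x, Continuous (duhamel K fun τ => g τ (ext x τ)) := fun x => by
    obtain ⟨L', hL'⟩ := hgb ‖x‖
    exact continuous_duhamel hK hKb (hmeas x _) fun τ _ => hL' τ _ (hextb x τ)
  let Ψ : C(Icc (0 : ℝ) T, E) → C(Icc (0 : ℝ) T, E) := fun x =>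
    ⟨fun t => a t + duhamel K (fun τ => g τ (ext x τ)) t,
      ((ha.add (hcont x)).comp continuous_subtype_val)⟩
  have hΨ : ∀ x (t : Icc (0 : ℝ) T),
      Ψ x t = a t + ∫ τ in (0 : ℝ)..t, K (t - τ) (g τ (ext x τ)) := fun x t => by
    change a t + duhamel K (fun τ => g τ (ext x τ)) t = _
    rw [duhamel_eq K _ t.2.1 (t.2.2.trans hT₁)]
  have hint : ∀ x (t : Icc (0 : ℝ) T),
      IntervalIntegrable (fun τ => K (t - τ) (g τ (ext x τ))) volume 0 t := fun x t => by
    obtain ⟨L', hL'⟩ := hgb ‖x‖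
    exact intervalIntegrable_kernel hK hKb t.2.1 (t.2.2.trans hT₁) (hmeas x _)
      fun τ _ => hL' τ _ (hextb x τ)
  set s : Set C(Icc (0 : ℝ) T, E) := Metric.closedBall 0 R with hs
  have hmem : ∀ x ∈ s, ‖x‖ ≤ R := fun x hx => by simpa [hs] using hx
  have hmaps : MapsTo Ψ s s := by
    intro x hx
    rw [hs, mem_closedBall_zero_iff, ContinuousMap.norm_le _ (by linarith)]
    intro t
    rw [hΨ]
    have h1 := hA t ⟨t.2.1, t.2.2.trans hT₁⟩
    have h2 : ‖∫ τ in (0 : ℝ)..t, K (t - τ) (g τ (ext x τ))‖ ≤ 2 * (L * R) * |(t : ℝ) - 0| := by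
      refine intervalIntegral.norm_integral_le_of_norm_le_const fun τ hτ => ?_
      rw [uIoc_of_le t.2.1] at hτ
      refine (norm_kernel_le hKb hτ (t.2.2.trans hT₁) _).trans ?_
      have h := hL τ (ext x τ) 0 ((hextb x τ).trans (hmem x hx)) (by simp; linarith)
      rw [hg₀, sub_zero, sub_zero] at h
      have := (hextb x τ).trans (hmem x hx)
      nlinarith
    rw [sub_zero, abs_of_nonneg t.2.1] at h2
    have h3 : 2 * (L * R) * t ≤ 2 * (L * R) * T := by
      have := t.2.2; gcongr
    calc _ ≤ _ := norm_add_le _ _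
      _ ≤ R := by linarith
  have hcontr : ContractingWith (1 / 2) (hmaps.restrict Ψ s s) := by
    refine ⟨by rw [div_lt_one (by norm_num)]; norm_num, LipschitzWith.of_dist_le_mul ?_⟩
    rintro ⟨x, hx⟩ ⟨y, hy⟩
    rw [Subtype.dist_eq, Subtype.dist_eq]
    change dist (Ψ x) (Ψ y) ≤ _ * dist x y
    rw [ContinuousMap.dist_le (by positivity)]
    intro t
    rw [hΨ, hΨ, dist_add_left, dist_eq_norm, ← intervalIntegral.integral_sub (hint x t) (hint y t)]
    have h2 : ‖∫ τ in (0 : ℝ)..t, (K (t - τ) (g τ (ext x τ)) - K (t - τ) (g τ (ext y τ)))‖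
        ≤ 2 * (L * dist x y) * |(t : ℝ) - 0| := by
      refine intervalIntegral.norm_integral_le_of_norm_le_const fun τ hτ => ?_
      rw [uIoc_of_le t.2.1] at hτ
      rw [← map_sub]
      refine (norm_kernel_le hKb hτ (t.2.2.trans hT₁) _).trans ?_
      have h := hL τ (ext x τ) (ext y τ) ((hextb x τ).trans (hmem x hx))
        ((hextb y τ).trans (hmem y hy))
      have h' : ‖ext x τ - ext y τ‖ ≤ dist x y := by
        rw [← dist_eq_norm]; exact ContinuousMap.dist_apply_le_dist _
      have := mul_le_mul_of_nonneg_left h' hL₀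
      linarith
    rw [sub_zero, abs_of_nonneg t.2.1] at h2
    refine h2.trans ?_
    have h3 := t.2.2
    have h4 : 0 ≤ dist x y := dist_nonneg
    calc 2 * (L * dist x y) * t ≤ 2 * (L * dist x y) * T := by gcongr
      _ = 2 * L * T * dist x y := by ring
      _ ≤ 1 / 2 * dist x y := by gcongr
      _ = _ := by simp
  obtain ⟨x, hx, hfix, -, -⟩ := ContractingWith.exists_fixedPoint'
    (Metric.isClosed_closedBall.isComplete : IsComplete s) hmaps hcontr (x := 0)
    (by simp; linarith) (edist_ne_top _ _)
  refine ⟨T, hT₀, hT₁, ext x, hext x, ⟨‖x‖, hextb x⟩, fun t ht => ?_⟩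
  rw [← hΨ x ⟨t, ht⟩, hfix]
  exact congrArg x (projIcc_of_mem hT₀.le ht)

/-- Two bounded solutions of a Volterra equation on `[0,T)` agree: iterating
`d(t) ≤ c ∫₀ᵗ d(τ) dτ` bounds their distance `d(t)` by `2R (ct)ⁿ / n!` for every `n`. -/
theorem volterra_solution_unique {K : ℝ → Y →L[ℝ] E}
    (hK : Continuous fun q : ℝ × Y => K q.1 q.2) (hKb : ∀ t y, ‖K t y‖ ≤ (1 + |t|) * ‖y‖)
    {a : ℝ → E} {g : ℝ → E → Y} (hg₀ : ∀ τ, g τ 0 = 0)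
    (hgL : ∀ R, ∃ L, 0 ≤ L ∧ ∀ τ x y, ‖x‖ ≤ R → ‖y‖ ≤ R → ‖g τ x - g τ y‖ ≤ L * ‖x - y‖)
    (hgm : ∀ (x : ℝ → E) (s : Set ℝ), AEStronglyMeasurable x (volume.restrict s) →
      AEStronglyMeasurable (fun τ => g τ (x τ)) (volume.restrict s))
    {T R : ℝ} (hT₁ : T ≤ 1) {x y : ℝ → E} (hx : ContinuousOn x (Ico 0 T))
    (hy : ContinuousOn y (Ico 0 T)) (hxR : ∀ t ∈ Ico 0 T, ‖x t‖ ≤ R)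
    (hyR : ∀ t ∈ Ico 0 T, ‖y t‖ ≤ R)
    (hxe : ∀ t ∈ Ico 0 T, x t = a t + ∫ τ in (0 : ℝ)..t, K (t - τ) (g τ (x τ)))
    (hye : ∀ t ∈ Ico 0 T, y t = a t + ∫ τ in (0 : ℝ)..t, K (t - τ) (g τ (y τ))) :
    ∀ t ∈ Ico 0 T, x t = y t := by
  obtain ⟨L, hL₀, hL⟩ := hgL R
  have hsub : ∀ t ∈ Ico 0 T, Ioc 0 t ⊆ Ico 0 T := fun t ht τ hτ =>
    ⟨hτ.1.le, hτ.2.trans_lt ht.2⟩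
  have hint : ∀ z : ℝ → E, ContinuousOn z (Ico 0 T) → (∀ t ∈ Ico 0 T, ‖z t‖ ≤ R) → ∀ t ∈ Ico 0 T,
      IntervalIntegrable (fun τ => K (t - τ) (g τ (z τ))) volume 0 t := by
    intro z hz hzR t ht
    obtain ⟨M, hM⟩ := exists_bound_on_ball hg₀ hgL R
    exact intervalIntegrable_kernel hK hKb ht.1 (ht.2.le.trans hT₁)
      (hgm z _ ((hz.mono (hsub t ht)).aestronglyMeasurable measurableSet_Ioc))
      fun τ hτ => hM τ _ (hzR τ (hsub t ht hτ))
  have key : ∀ n : ℕ, ∀ t ∈ Ico 0 T,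
      ‖x t - y t‖ ≤ 2 * R * ((2 * L * t) ^ n / n.factorial) := by
    intro n
    induction n with
    | zero =>
      intro t ht
      have h := norm_sub_le (x t) (y t)
      have h1 := hxR t ht
      have h2 := hyR t ht
      simp only [pow_zero, Nat.factorial_zero, Nat.cast_one, div_one, mul_one]
      linarith
    | succ n ih =>
      intro t ht
      rw [hxe t ht, hye t ht, add_sub_add_left_eq_sub,
        ← intervalIntegral.integral_sub (hint x hx hxR t ht) (hint y hy hyR t ht)]
      set c : ℝ := 2 * L * (2 * R * ((2 * L) ^ n / n.factorial)) with hc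
      have h1 : ‖∫ τ in (0 : ℝ)..t, (K (t - τ) (g τ (x τ)) - K (t - τ) (g τ (y τ)))‖
          ≤ ∫ τ in (0 : ℝ)..t, c * τ ^ n := by
        refine intervalIntegral.norm_integral_le_of_norm_le ht.1
          (Eventually.of_forall fun τ hτ => ?_) ((by fun_prop : Continuous fun τ : ℝ =>
            c * τ ^ n).intervalIntegrable _ _)
        have hτ' := hsub t ht hτ
        rw [← map_sub]
        refine (norm_kernel_le hKb hτ (ht.2.le.trans hT₁) _).trans ?_
        have h2 := hL τ (x τ) (y τ) (hxR τ hτ') (hyR τ hτ')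
        have h3 := mul_le_mul_of_nonneg_left (ih τ hτ') hL₀
        have h4 : c * τ ^ n = 2 * (L * (2 * R * ((2 * L * τ) ^ n / n.factorial))) := by
          rw [hc, mul_pow (2 * L)]; ring
        rw [h4]
        linarith
      refine h1.trans_eq ?_
      rw [intervalIntegral.integral_const_mul, integral_pow, hc, Nat.factorial_succ]
      push_cast
      have : (n.factorial : ℝ) ≠ 0 := by positivity
      have : ((n : ℝ) + 1) ≠ 0 := by positivity
      field_simp
      ring
  intro t ht
  have hlim : Tendsto (fun n : ℕ => 2 * R * ((2 * L * t) ^ n / n.factorial)) atTop (𝓝 0) := by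
    simpa using (FloorSemiring.tendsto_pow_div_factorial_atTop (2 * L * t)).const_mul (2 * R)
  have h := ge_of_tendsto' hlim fun n => key n t ht
  exact sub_eq_zero.mp (norm_le_zero_iff.mp h)

end Volterra

/-! ### The wave equation as a Volterra system -/

section WaveEquation

variable {N : ℕ} {σ : ℝ}

theorem norm_sinOp_le (t : ℝ) (y : RealL2 N) : ‖sinOp σ t y‖ ≤ (1 + |t|) * ‖y‖ :=
  (norm_radialOp_le (by fun_prop) (fun _ _ => abs_sin_mul_div_le _ _) y).trans
    (mul_le_mul_of_nonneg_right (by linarith) (norm_nonneg _))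

theorem continuous_uncurry_sinOp (hN : 0 < N) :
    Continuous fun q : ℝ × RealL2 N => sinOp σ q.1 q.2 :=
  continuous_uncurry_of_bound
    (fun y => continuous_iff_continuousAt.mpr fun t => (hasDerivAt_sinOp hN y t).continuousAt)
    norm_sinOp_le

theorem norm_cosOp_le' (t : ℝ) (y : RealL2 N) : ‖cosOp σ t y‖ ≤ (1 + |t|) * ‖y‖ :=
  (norm_cosOp_le t y).trans
    (le_mul_of_one_le_left (norm_nonneg _) (by linarith [abs_nonneg t]))

theorem sinOp_zero (y : RealL2 N) : sinOp σ 0 y = 0 := by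
  have h : ‖sinOp σ 0 y‖ ≤ |(0 : ℝ)| * ‖y‖ :=
    norm_radialOp_le (by fun_prop) (fun _ _ => abs_sin_mul_div_le _ _) y
  rw [abs_zero, zero_mul] at h
  exact norm_le_zero_iff.mp h

/-- The Duhamel kernel of the first-order system for `(⟨∇⟩^(σ/2) u, ∂_t u)`. -/
noncomputable def energyKernel (σ t : ℝ) : RealL2 N →L[ℝ] RealL2 N × RealL2 N :=
  (liftedSinOp σ t).prod (cosOp σ t)

theorem continuous_uncurry_energyKernel (hN : 0 < N) (hσ₀ : 0 ≤ σ) (hσ₂ : σ ≤ 2) :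
    Continuous fun q : ℝ × RealL2 N => energyKernel σ q.1 q.2 :=
  (continuous_uncurry_of_bound (continuous_liftedSinOp hN hσ₀ hσ₂)
    (norm_liftedSinOp_le hσ₀ hσ₂)).prodMk
    (continuous_uncurry_of_bound (continuous_cosOp hN) norm_cosOp_le')

theorem norm_energyKernel_le (hσ₀ : 0 ≤ σ) (hσ₂ : σ ≤ 2) (t : ℝ) (y : RealL2 N) :
    ‖energyKernel σ t y‖ ≤ (1 + |t|) * ‖y‖ :=
  max_le (norm_liftedSinOp_le hσ₀ hσ₂ t y) (norm_cosOp_le' t y)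

/-- The free evolution of `(⟨∇⟩^(σ/2) u, ∂_t u)` with data `u(0) = ⟨∇⟩^(-σ/2) w₀`,
`∂_t u(0) = u₁`. -/
noncomputable def energyFree (σ : ℝ) (w₀ u₁ : RealL2 N) (t : ℝ) : RealL2 N × RealL2 N :=
  (cosOp σ t w₀ + liftedSinOp σ t u₁, derivCosOp σ t w₀ + cosOp σ t u₁)

theorem continuous_energyFree (hN : 0 < N) (hσ₀ : 0 ≤ σ) (hσ₂ : σ ≤ 2) (w₀ u₁ : RealL2 N) :
    Continuous (energyFree σ w₀ u₁) :=
  ((continuous_cosOp hN w₀).add (continuous_liftedSinOp hN hσ₀ hσ₂ u₁)).prodMk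
    ((continuous_derivCosOp hN hσ₀ w₀).add (continuous_cosOp hN u₁))

/-- The forcing term `f(u) - b ∂_t u` in the variables `(⟨∇⟩^(σ/2) u, ∂_t u)`. -/
noncomputable def forcing (σ : ℝ) (b f : ℝ → ℝ) (τ : ℝ) (x : RealL2 N × RealL2 N) : RealL2 N :=
  nemytskii σ f x.1 - b τ • x.2

/-- The system `x(t) = a(t) + ∫₀ᵗ K(t-τ) g(τ, x(τ)) dτ`, componentwise: the first component, mapped
to `H^(σ/2)`, is the mild formula, and the second one is its time derivative. -/
theorem energy_equation_iff (hN : 0 < N) (hσ₀ : 0 ≤ σ) (hσ₂ : σ ≤ 2) {w₀ u₁ : RealL2 N}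
    {G : ℝ → RealL2 N} {t B : ℝ} (ht₀ : 0 ≤ t) (ht₁ : t ≤ 1)
    (hG : AEStronglyMeasurable G (volume.restrict (Ioc 0 t))) (hB : ∀ τ ∈ Ioc 0 t, ‖G τ‖ ≤ B)
    (x : RealL2 N × RealL2 N) :
    x = energyFree σ w₀ u₁ t + ∫ τ in (0 : ℝ)..t, energyKernel σ (t - τ) (G τ) ↔
      besselOp σ x.1 = cosOp σ t (besselOp σ w₀) + sinOp σ t u₁
        + ∫ τ in (0 : ℝ)..t, sinOp σ (t - τ) (G τ) ∧
      x.2 = derivCosOp σ t w₀ + cosOp σ t u₁ + ∫ τ in (0 : ℝ)..t, cosOp σ (t - τ) (G τ) := by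
  have hint := intervalIntegrable_kernel (continuous_uncurry_energyKernel hN hσ₀ hσ₂)
    (norm_energyKernel_le hσ₀ hσ₂) ht₀ ht₁ hG hB
  have hintS := intervalIntegrable_kernel (continuous_uncurry_of_bound
    (continuous_liftedSinOp hN hσ₀ hσ₂) (norm_liftedSinOp_le hσ₀ hσ₂)) (norm_liftedSinOp_le hσ₀ hσ₂)
    ht₀ ht₁ hG hB
  have h1 : (∫ τ in (0 : ℝ)..t, energyKernel σ (t - τ) (G τ)).1 =
      ∫ τ in (0 : ℝ)..t, liftedSinOp σ (t - τ) (G τ) :=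
    ((ContinuousLinearMap.fst ℝ (RealL2 N) (RealL2 N)).intervalIntegral_comp_comm hint).symm
  have h2 : (∫ τ in (0 : ℝ)..t, energyKernel σ (t - τ) (G τ)).2 =
      ∫ τ in (0 : ℝ)..t, cosOp σ (t - τ) (G τ) :=
    ((ContinuousLinearMap.snd ℝ (RealL2 N) (RealL2 N)).intervalIntegral_comp_comm hint).symm
  have h3 : besselOp σ (∫ τ in (0 : ℝ)..t, liftedSinOp σ (t - τ) (G τ)) =
      ∫ τ in (0 : ℝ)..t, sinOp σ (t - τ) (G τ) := by
    rw [← ContinuousLinearMap.intervalIntegral_comp_comm _ hintS]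
    simp only [besselOp_liftedSinOp hσ₀ hσ₂]
  rw [Prod.ext_iff, Prod.fst_add, Prod.snd_add, h1, h2, ← (besselOp_injective hσ₀).eq_iff,
    map_add, h3, energyFree, map_add, besselOp_cosOp hσ₀, besselOp_liftedSinOp hσ₀ hσ₂]

/-- The mild formula is differentiable in `L²`, whatever the bounded measurable forcing. -/
theorem hasDerivAt_mild (hN : 0 < N) (hσ₀ : 0 ≤ σ) {w₀ u₁ : RealL2 N}
    {G : ℝ → RealL2 N} {B : ℝ} (hG : AEStronglyMeasurable G (volume.restrict (Ioc 0 1)))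
    (hB : ∀ τ ∈ Ioc (0 : ℝ) 1, ‖G τ‖ ≤ B) (t : ℝ) :
    HasDerivAt (fun t => cosOp σ t (besselOp σ w₀) + sinOp σ t u₁ + duhamel (sinOp σ) G t)
      (derivCosOp σ t w₀ + cosOp σ t u₁ + duhamel (cosOp σ) G t) t :=
  ((hasDerivAt_cosOp_besselOp hN hσ₀ w₀ t).add (hasDerivAt_sinOp hN u₁ t)).add
    (hasDerivAt_duhamel (continuous_uncurry_sinOp hN)
      (continuous_uncurry_of_bound (continuous_cosOp hN) norm_cosOp_le')
      (fun y t => hasDerivAt_sinOp hN y t) sinOp_zero norm_cosOp_le hG hB t)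

/-- A function in `L^∞(0,1)` has a representative that is measurable and bounded on all of `ℝ`. -/
theorem exists_bounded_representative {b : ℝ → ℝ}
    (hb : MemLp b ∞ (volume.restrict (Ioo (0 : ℝ) 1))) :
    ∃ b' : ℝ → ℝ, Measurable b' ∧ (∃ B, ∀ τ, |b' τ| ≤ B) ∧
      ∀ᵐ τ ∂volume.restrict (Ioo (0 : ℝ) 1), b τ = b' τ := by
  set B := (eLpNorm b ∞ (volume.restrict (Ioo (0 : ℝ) 1))).toReal with hB
  have hB₀ : 0 ≤ B := ENNReal.toReal_nonneg
  have hm : Measurable (hb.1.mk b) := hb.1.stronglyMeasurable_mk.measurable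
  refine ⟨fun τ => max (-B) (min (hb.1.mk b τ) B), by fun_prop, ⟨B, fun τ => ?_⟩, ?_⟩
  · exact abs_le.mpr ⟨le_max_left _ _, max_le (by linarith) (min_le_right _ _)⟩
  · have hbd := ae_le_eLpNormEssSup (f := b) (μ := volume.restrict (Ioo (0 : ℝ) 1))
    filter_upwards [hb.1.ae_eq_mk, hbd] with τ h1 h2
    rw [← eLpNorm_exponent_top, ← ofReal_norm,
      ENNReal.ofReal_le_iff_le_toReal hb.2.ne, Real.norm_eq_abs] at h2
    have h3 := abs_le.mp h2
    rw [← h1, min_eq_left h3.2, max_eq_right h3.1]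

/-- The two integrals of the mild formula, combined into the real-valued Duhamel integral of the
forcing. The coefficient `b` may be changed on a null set of `(0,1)`. -/
theorem duhamel_waveS (hN : 0 < N) {b b' : ℝ → ℝ} (hb'm : Measurable b') {B : ℝ}
    (hb'B : ∀ τ, |b' τ| ≤ B) (hbb' : ∀ᵐ τ ∂volume.restrict (Ioo (0 : ℝ) 1), b τ = b' τ)
    {d F : ℝ → RealL2 N} {t M : ℝ} (ht₀ : 0 ≤ t) (ht₁ : t < 1)
    (hd : AEStronglyMeasurable d (volume.restrict (Ioc 0 t))) (hdM : ∀ τ ∈ Ioc 0 t, ‖d τ‖ ≤ M)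
    (hF : AEStronglyMeasurable F (volume.restrict (Ioc 0 t))) (hFM : ∀ τ ∈ Ioc 0 t, ‖F τ‖ ≤ M) :
    IntervalIntegrable (fun τ => waveS σ (t - τ) (b τ • d τ)) volume 0 t ∧
    IntervalIntegrable (fun τ => waveS σ (t - τ) (F τ)) volume 0 t ∧
    ∀ z : ComplexL2 N, z - (∫ τ in (0 : ℝ)..t, waveS σ (t - τ) (b τ • d τ))
        + (∫ τ in (0 : ℝ)..t, waveS σ (t - τ) (F τ)) =
      z + complexify (∫ τ in (0 : ℝ)..t, sinOp σ (t - τ) (F τ - b' τ • d τ)) := by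
  have hB₀ : 0 ≤ B := (abs_nonneg _).trans (hb'B 0)
  have hI : ∀ {G : ℝ → RealL2 N} {M' : ℝ}, AEStronglyMeasurable G (volume.restrict (Ioc 0 t)) →
      (∀ τ ∈ Ioc 0 t, ‖G τ‖ ≤ M') →
      IntervalIntegrable (fun τ => sinOp σ (t - τ) (G τ)) volume 0 t := fun hG hM' =>
    intervalIntegrable_kernel (continuous_uncurry_sinOp hN) norm_sinOp_le ht₀ ht₁.le hG hM'
  have hIF := hI hF hFM
  have hId := hI (G := fun τ => b' τ • d τ) (M' := B * M)
    (hb'm.aestronglyMeasurable.smul hd) fun τ hτ => by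
      rw [norm_smul]
      exact mul_le_mul (hb'B τ) (hdM τ hτ) (norm_nonneg _) hB₀
  have hae : ∀ᵐ τ, τ ∈ uIoc 0 t →
      complexify (sinOp σ (t - τ) (b' τ • d τ)) = waveS σ (t - τ) (b τ • d τ) := by
    rw [ae_restrict_iff' measurableSet_Ioo] at hbb'
    filter_upwards [hbb'] with τ h hτ
    rw [uIoc_of_le ht₀] at hτ
    rw [← complexify_sinOp, h ⟨hτ.1, hτ.2.trans_lt ht₁⟩]
  have hIF' : IntervalIntegrable (fun τ => waveS σ (t - τ) (F τ)) volume 0 t := by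
    simp only [← complexify_sinOp]
    exact ⟨complexify.integrable_comp hIF.1, complexify.integrable_comp hIF.2⟩
  have hId' : IntervalIntegrable (fun τ => complexify (sinOp σ (t - τ) (b' τ • d τ))) volume 0 t :=
    ⟨complexify.integrable_comp hId.1, complexify.integrable_comp hId.2⟩
  refine ⟨hId'.congr_ae ((ae_restrict_iff' measurableSet_uIoc).mpr hae), hIF', fun z => ?_⟩
  have e1 : ∫ τ in (0 : ℝ)..t, waveS σ (t - τ) (b τ • d τ) =
      complexify (∫ τ in (0 : ℝ)..t, sinOp σ (t - τ) (b' τ • d τ)) := by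
    rw [← ContinuousLinearMap.intervalIntegral_comp_comm _ hId]
    exact (intervalIntegral.integral_congr_ae hae).symm
  have e2 : ∫ τ in (0 : ℝ)..t, waveS σ (t - τ) (F τ) =
      complexify (∫ τ in (0 : ℝ)..t, sinOp σ (t - τ) (F τ)) := by
    rw [← ContinuousLinearMap.intervalIntegral_comp_comm _ hIF]
    simp only [complexify_sinOp]
  rw [e1, e2]
  simp only [map_sub]
  rw [intervalIntegral.integral_sub hIF hId, map_sub]
  abel

theorem complexify_injective : Function.Injective (complexify : RealL2 N → ComplexL2 N) :=
  (injective_iff_map_eq_zero _).mpr fun g hg => by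
    rw [← norm_eq_zero, ← norm_complexify, hg, norm_zero]

theorem nemytskii_zero {f : ℝ → ℝ} (hf₀ : f 0 = 0)
    (hspec : ∀ w : RealL2 N, nemytskii σ f w =ᵐ[volume] fun x => f (besselOp σ w x)) :
    nemytskii σ f (0 : RealL2 N) = 0 := by
  refine Lp.ext ?_
  filter_upwards [hspec 0, Lp.coeFn_zero ℝ 2 (volume : Measure (EuclideanSpace ℝ (Fin N)))]
    with x h1 h2
  rw [map_zero] at h1
  rw [h1, h2, Pi.zero_apply, hf₀]

theorem continuous_of_lipschitz_on_balls {X Z : Type*} [NormedAddCommGroup X]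
    [NormedAddCommGroup Z] {φ : X → Z}
    (hφ : ∀ R, ∃ L, 0 ≤ L ∧ ∀ w z, ‖w‖ ≤ R → ‖z‖ ≤ R → ‖φ w - φ z‖ ≤ L * ‖w - z‖) :
    Continuous φ := by
  refine continuous_iff_continuousAt.mpr fun z => ?_
  obtain ⟨L, -, hL⟩ := hφ (‖z‖ + 1)
  have hev : ∀ᶠ w in 𝓝 z, ‖w‖ < ‖z‖ + 1 :=
    (continuous_norm.tendsto z).eventually (gt_mem_nhds (by linarith))
  have h0 : Tendsto (fun w => L * ‖w - z‖) (𝓝 z) (𝓝 0) := by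
    have : Continuous fun w => L * ‖w - z‖ := by fun_prop
    simpa using this.tendsto z
  refine tendsto_iff_norm_sub_tendsto_zero.mpr (squeeze_zero' (Eventually.of_forall fun _ =>
    norm_nonneg _) ?_ h0)
  filter_upwards [hev] with w hw
  exact hL w z hw.le (by linarith)

end WaveEquation

/-! ### Mild solutions and Volterra solutions -/

section MildSolutions

variable {N : ℕ} {σ : ℝ} {b b' f : ℝ → ℝ} {B : ℝ} {u₀ u₁ w₀ : RealL2 N} {T : ℝ}

theorem forcing_lipschitz (hb' : ∀ τ, |b' τ| ≤ B)
    (hL : ∀ R, ∃ L, 0 ≤ L ∧ ∀ w z : RealL2 N, ‖w‖ ≤ R → ‖z‖ ≤ R →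
      ‖nemytskii σ f w - nemytskii σ f z‖ ≤ L * ‖w - z‖) (R : ℝ) :
    ∃ L, 0 ≤ L ∧ ∀ (τ : ℝ) (x y : RealL2 N × RealL2 N), ‖x‖ ≤ R → ‖y‖ ≤ R →
      ‖forcing σ b' f τ x - forcing σ b' f τ y‖ ≤ L * ‖x - y‖ := by
  have hB₀ : 0 ≤ B := (abs_nonneg _).trans (hb' 0)
  obtain ⟨L, hL₀, hL⟩ := hL R
  refine ⟨L + B, by positivity, fun τ x y hx hy => ?_⟩
  have h1 := hL x.1 y.1 ((norm_fst_le x).trans hx) ((norm_fst_le y).trans hy)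
  have h2 : ‖b' τ • (x.2 - y.2)‖ ≤ B * ‖x.2 - y.2‖ := by
    rw [norm_smul]; exact mul_le_mul_of_nonneg_right (hb' τ) (norm_nonneg _)
  have h3 : ‖x.1 - y.1‖ ≤ ‖x - y‖ := norm_fst_le (x - y)
  have h4 : ‖x.2 - y.2‖ ≤ ‖x - y‖ := norm_snd_le (x - y)
  have e : forcing σ b' f τ x - forcing σ b' f τ y =
      (nemytskii σ f x.1 - nemytskii σ f y.1) - b' τ • (x.2 - y.2) := by
    rw [forcing, forcing, smul_sub]; abel
  rw [e, add_mul]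
  exact (norm_sub_le _ _).trans (add_le_add (h1.trans (by gcongr)) (h2.trans (by gcongr)))

theorem aestronglyMeasurable_forcing (hb' : Measurable b')
    (hn : Continuous (nemytskii σ f : RealL2 N → RealL2 N)) {x : ℝ → RealL2 N × RealL2 N}
    {μ : Measure ℝ} (hx : AEStronglyMeasurable x μ) :
    AEStronglyMeasurable (fun τ => forcing σ b' f τ (x τ)) μ :=
  (hn.comp_aestronglyMeasurable hx.fst).sub (hb'.aestronglyMeasurable.smul hx.snd)

/-- A bounded solution of the Volterra system yields a mild solution. -/
theorem isMildSolution_of_volterra (hN : 0 < N) (hσ₀ : 0 ≤ σ) (hσ₂ : σ ≤ 2)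
    (hb'm : Measurable b') (hb'B : ∀ τ, |b' τ| ≤ B)
    (hbb' : ∀ᵐ τ ∂volume.restrict (Ioo (0 : ℝ) 1), b τ = b' τ) (hf₀ : f 0 = 0)
    (hspec : ∀ w : RealL2 N, nemytskii σ f w =ᵐ[volume] fun x => f (besselOp σ w x))
    (hL : ∀ R, ∃ L, 0 ≤ L ∧ ∀ w z : RealL2 N, ‖w‖ ≤ R → ‖z‖ ≤ R →
      ‖nemytskii σ f w - nemytskii σ f z‖ ≤ L * ‖w - z‖)
    (hT₁ : T ≤ 1) {x : ℝ → RealL2 N × RealL2 N} (hx : Continuous x) {R : ℝ} (hR : ∀ t, ‖x t‖ ≤ R)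
    (hxe : ∀ t ∈ Ico 0 T, x t = energyFree σ w₀ u₁ t +
      ∫ τ in (0 : ℝ)..t, energyKernel σ (t - τ) (forcing σ b' f τ (x τ))) :
    IsMildSolution σ b f (besselOp σ w₀) u₁ T fun t => besselOp σ (x t).1 := by
  have hn₀ := nemytskii_zero hf₀ hspec
  have hnc := continuous_of_lipschitz_on_balls hL
  set G : ℝ → RealL2 N := fun τ => forcing σ b' f τ (x τ) with hGdef
  have hG : ∀ s : Set ℝ, AEStronglyMeasurable G (volume.restrict s) := fun s =>
    aestronglyMeasurable_forcing hb'm hnc hx.aestronglyMeasurable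
  obtain ⟨M, hM⟩ := exists_bound_on_ball (φ := forcing (N := N) σ b' f)
    (fun τ => by rw [forcing, Prod.fst_zero, Prod.snd_zero, hn₀, smul_zero, sub_zero])
    (forcing_lipschitz hb'B hL) R
  have hGM : ∀ τ, ‖G τ‖ ≤ M := fun τ => hM τ _ (hR τ)
  have heq : ∀ t ∈ Ico 0 T, besselOp σ (x t).1 = cosOp σ t (besselOp σ w₀) + sinOp σ t u₁
      + ∫ τ in (0 : ℝ)..t, sinOp σ (t - τ) (G τ) ∧
      (x t).2 = derivCosOp σ t w₀ + cosOp σ t u₁ + ∫ τ in (0 : ℝ)..t, cosOp σ (t - τ) (G τ) :=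
    fun t ht => (energy_equation_iff hN hσ₀ hσ₂ ht.1 (ht.2.le.trans hT₁) (hG _)
      (fun τ _ => hGM τ) (x t)).mp (hxe t ht)
  have hud : UniqueDiffOn ℝ (Ico 0 T) := uniqueDiffOn_Ico 0 T
  have hderiv : ∀ t ∈ Ico 0 T,
      HasDerivWithinAt (fun t => besselOp σ (x t).1) (x t).2 (Ico 0 T) t := by
    intro t ht
    have h := (hasDerivAt_mild hN hσ₀ (w₀ := w₀) (u₁ := u₁) (hG _) (fun τ _ => hGM τ)
      t).hasDerivWithinAt (s := Ico 0 T)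
    have h2 : (x t).2 = derivCosOp σ t w₀ + cosOp σ t u₁ + duhamel (cosOp σ) G t := by
      rw [(heq t ht).2, duhamel_eq _ _ ht.1 (ht.2.le.trans hT₁)]
    have hcongr : ∀ r ∈ Ico 0 T, besselOp σ (x r).1 =
        cosOp σ r (besselOp σ w₀) + sinOp σ r u₁ + duhamel (sinOp σ) G r := fun r hr => by
      rw [(heq r hr).1, duhamel_eq _ _ hr.1 (hr.2.le.trans hT₁)]
    rw [h2]
    exact h.congr hcongr (hcongr t ht)
  have htd : ∀ t ∈ Ico 0 T, timeDeriv T (fun t => besselOp σ (x t).1) t = (x t).2 :=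
    fun t ht => (hderiv t ht).derivWithin (hud t ht)
  have hx₂ : Continuous fun t => (x t).2 := continuous_snd.comp hx
  have hx₁ : Continuous fun t => (x t).1 := continuous_fst.comp hx
  refine ⟨⟨fun t _ => (memHs_iff hσ₀).mpr ⟨_, rfl⟩, fun t₀ _ => ?_, ?_⟩,
    ⟨R.toNNReal, fun t _ => ?_⟩, ⟨R, fun t ht => ?_⟩, fun t => nemytskii σ f (x t).1, fun t _ => hspec _, fun t ht => ?_⟩
  · simp only [← map_sub, sobolevENorm_besselOp hσ₀]
    have hc : Continuous fun t => ‖(x t).1 - (x t₀).1‖ₑ := by fun_prop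
    simpa using (hc.tendsto t₀).mono_left nhdsWithin_le_nhds
  · rw [contDiffOn_one_iff_derivWithin hud]
    exact ⟨fun t ht => (hderiv t ht).differentiableWithinAt, hx₂.continuousOn.congr htd⟩
  · rw [sobolevENorm_besselOp hσ₀, ← ofReal_norm]
    exact ENNReal.ofReal_le_ofReal ((norm_fst_le _).trans (hR t))
  · rw [htd t ht]
    exact (norm_snd_le _).trans (hR t)
  · have hsub : ∀ τ ∈ Ioc 0 t, τ ∈ Ico 0 T := fun τ hτ => ⟨hτ.1.le, hτ.2.trans_lt ht.2⟩
    obtain ⟨Mn, hMn⟩ := exists_bound_on_ball (φ := fun _ : ℝ => nemytskii (N := N) σ f)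
      (fun _ => hn₀) (fun R => by
        obtain ⟨L, h0, h⟩ := hL R
        exact ⟨L, h0, fun _ => h⟩) R
    obtain ⟨h1, h2, h3⟩ := duhamel_waveS (σ := σ) hN hb'm hb'B hbb'
      (d := timeDeriv T fun t => besselOp σ (x t).1) (F := fun τ => nemytskii σ f (x τ).1)
      (M := max R Mn) ht.1 (ht.2.trans_le hT₁)
      (hx₂.aestronglyMeasurable.congr (by
        filter_upwards [ae_restrict_mem measurableSet_Ioc] with τ hτ
        exact (htd τ (hsub τ hτ)).symm))
      (fun τ hτ => by
        rw [htd τ (hsub τ hτ)]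
        exact ((norm_snd_le _).trans (hR τ)).trans (le_max_left _ _))
      (hnc.comp hx₁).aestronglyMeasurable
      (fun τ _ => (hMn 0 _ ((norm_fst_le _).trans (hR τ))).trans (le_max_right _ _))
    refine ⟨h1, h2, ?_⟩
    rw [h3, (heq t ht).1, map_add, map_add, complexify_cosOp, complexify_sinOp]
    congr 2
    refine intervalIntegral.integral_congr fun τ hτ => ?_
    rw [uIcc_of_le ht.1] at hτ
    simp only [hGdef, forcing]
    rw [htd τ ⟨hτ.1, hτ.2.trans_lt ht.2⟩]

/-- A mild solution yields a bounded solution of the Volterra system. -/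
theorem IsMildSolution.exists_volterra (hN : 0 < N) (hσ₀ : 0 ≤ σ) (hσ₂ : σ ≤ 2)
    (hb'm : Measurable b') (hb'B : ∀ τ, |b' τ| ≤ B)
    (hbb' : ∀ᵐ τ ∂volume.restrict (Ioo (0 : ℝ) 1), b τ = b' τ) (hf₀ : f 0 = 0)
    (hspec : ∀ w : RealL2 N, nemytskii σ f w =ᵐ[volume] fun x => f (besselOp σ w x))
    (hL : ∀ R, ∃ L, 0 ≤ L ∧ ∀ w z : RealL2 N, ‖w‖ ≤ R → ‖z‖ ≤ R →
      ‖nemytskii σ f w - nemytskii σ f z‖ ≤ L * ‖w - z‖)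
    (hT₁ : T ≤ 1) {v : ℝ → RealL2 N} (hv : IsMildSolution σ b f (besselOp σ w₀) u₁ T v) :
    ∃ y : ℝ → RealL2 N × RealL2 N, ContinuousOn y (Ico 0 T) ∧
      (∃ R, ∀ t ∈ Ico 0 T, ‖y t‖ ≤ R) ∧ (∀ t ∈ Ico 0 T, v t = besselOp σ (y t).1) ∧
      ∀ t ∈ Ico 0 T, y t = energyFree σ w₀ u₁ t +
        ∫ τ in (0 : ℝ)..t, energyKernel σ (t - τ) (forcing σ b' f τ (y τ)) := by
  classical
  have hn₀ := nemytskii_zero hf₀ hspec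
  have hnc := continuous_of_lipschitz_on_balls hL
  have hud : UniqueDiffOn ℝ (Ico 0 T) := uniqueDiffOn_Ico 0 T
  have hw : ∀ t, ∃ w, t ∈ Ico 0 T → besselOp σ w = v t := fun t => by
    by_cases ht : t ∈ Ico 0 T
    · obtain ⟨w, hw⟩ := (memHs_iff hσ₀).mp (hv.mem_space.memHs t ht)
      exact ⟨w, fun _ => hw⟩
    · exact ⟨0, fun h => absurd h ht⟩
  choose w hw using hw
  obtain ⟨M₁, hM₁⟩ := hv.bounded_Hs
  obtain ⟨M₂, hM₂⟩ := hv.bounded_timeDeriv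
  have hwM : ∀ t ∈ Ico 0 T, ‖w t‖ ≤ M₁ := fun t ht => by
    have h := hM₁ t ht
    rw [← hw t ht, sobolevENorm_besselOp hσ₀, enorm_le_coe] at h
    exact_mod_cast h
  have hwc : ContinuousOn w (Ico 0 T) := by
    intro t₀ ht₀
    have h : Tendsto (fun t => ‖w t - w t₀‖ₑ) (𝓝[Ico 0 T] t₀) (𝓝 0) := by
      refine (hv.mem_space.continuous_Hs t₀ ht₀).congr' ?_
      filter_upwards [self_mem_nhdsWithin] with t ht
      rw [← hw t ht, ← hw t₀ ht₀, ← map_sub, sobolevENorm_besselOp hσ₀]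
    have h2 := (ENNReal.tendsto_toReal ENNReal.zero_ne_top).comp h
    refine tendsto_iff_norm_sub_tendsto_zero.mpr ?_
    simpa [Function.comp_def] using h2
  obtain ⟨hvd, hvc⟩ := (contDiffOn_one_iff_derivWithin hud).mp hv.mem_space.contDiff_L2
  set y : ℝ → RealL2 N × RealL2 N := fun t => (w t, timeDeriv T v t) with hy
  have hyc : ContinuousOn y (Ico 0 T) := hwc.prodMk hvc
  have hyR : ∀ t ∈ Ico 0 T, ‖y t‖ ≤ max (M₁ : ℝ) M₂ := fun t ht =>
    max_le_max (hwM t ht) (hM₂ t ht)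
  refine ⟨y, hyc, ⟨_, hyR⟩, fun t ht => (hw t ht).symm, ?_⟩
  set G : ℝ → RealL2 N := fun τ => forcing σ b' f τ (y τ) with hGdef
  obtain ⟨M, hM⟩ := exists_bound_on_ball (φ := forcing (N := N) σ b' f)
    (fun τ => by rw [forcing, Prod.fst_zero, Prod.snd_zero, hn₀, smul_zero, sub_zero])
    (forcing_lipschitz hb'B hL) (max M₁ M₂)
  obtain ⟨Mn, hMn⟩ := exists_bound_on_ball (φ := fun _ : ℝ => nemytskii (N := N) σ f)
    (fun _ => hn₀) (fun R => by
      obtain ⟨L, h0, h⟩ := hL R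
      exact ⟨L, h0, fun _ => h⟩) M₁
  have hsub : ∀ t ∈ Ico 0 T, Ioc 0 t ⊆ Ico 0 T := fun t ht τ hτ => ⟨hτ.1.le, hτ.2.trans_lt ht.2⟩
  have hGm : AEStronglyMeasurable G (volume.restrict (Ico 0 T)) :=
    aestronglyMeasurable_forcing hb'm hnc (hyc.aestronglyMeasurable measurableSet_Ico)
  have hGM : ∀ τ ∈ Ico 0 T, ‖G τ‖ ≤ M := fun τ hτ => hM τ _ (hyR τ hτ)
  obtain ⟨F, hF, hFe⟩ := hv.integral_eq
  have hFn : ∀ t ∈ Ico 0 T, F t = nemytskii σ f (w t) := fun t ht => by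
    refine Lp.ext ((hF t ht).trans ?_)
    rw [← hw t ht]
    exact (hspec _).symm
  have hmild : ∀ t ∈ Ico 0 T, v t = cosOp σ t (besselOp σ w₀) + sinOp σ t u₁
      + ∫ τ in (0 : ℝ)..t, sinOp σ (t - τ) (G τ) := by
    intro t ht
    obtain ⟨-, -, h3⟩ := duhamel_waveS (σ := σ) hN hb'm hb'B hbb' (d := timeDeriv T v) (F := F)
      (M := max M₂ Mn) ht.1 (ht.2.trans_le hT₁)
      ((hvc.mono (hsub t ht)).aestronglyMeasurable measurableSet_Ioc)
      (fun τ hτ => (hM₂ τ (hsub t ht hτ)).trans (le_max_left _ _))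
      ((((hnc.comp_continuousOn hwc).mono (hsub t ht)).aestronglyMeasurable
        measurableSet_Ioc).congr (by
          filter_upwards [ae_restrict_mem measurableSet_Ioc] with τ hτ
          exact (hFn τ (hsub t ht hτ)).symm))
      (fun τ hτ => by
        rw [hFn τ (hsub t ht hτ)]
        exact (hMn 0 _ (hwM τ (hsub t ht hτ))).trans (le_max_right _ _))
    refine complexify_injective ?_
    rw [(hFe t ht).2.2, h3, map_add, map_add, complexify_cosOp, complexify_sinOp]
    congr 2
    refine intervalIntegral.integral_congr fun τ hτ => ?_
    rw [uIcc_of_le ht.1] at hτ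
    simp only [hGdef, forcing, hy]
    rw [hFn τ ⟨hτ.1, hτ.2.trans_lt ht.2⟩]
  -- the forcing is only known on `[0,T)`, and is cut off outside
  set H : ℝ → RealL2 N := (Ico 0 T).indicator G with hH
  have hHm : AEStronglyMeasurable H (volume.restrict (Ioc 0 1)) :=
    ((aestronglyMeasurable_indicator_iff measurableSet_Ico).mpr hGm).restrict
  have hHM : ∀ τ ∈ Ioc (0 : ℝ) 1, ‖H τ‖ ≤ |M| := fun τ _ => by
    by_cases hτ : τ ∈ Ico 0 T
    · rw [hH, indicator_of_mem hτ]; exact (hGM τ hτ).trans (le_abs_self _)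
    · rw [hH, indicator_of_notMem hτ, norm_zero]; exact abs_nonneg _
  have hcut : ∀ K : ℝ → RealL2 N →L[ℝ] RealL2 N, ∀ t ∈ Ico 0 T,
      duhamel K H t = ∫ τ in (0 : ℝ)..t, K (t - τ) (G τ) := fun K t ht => by
    rw [duhamel_eq _ _ ht.1 (ht.2.le.trans hT₁)]
    refine intervalIntegral.integral_congr fun τ hτ => ?_
    rw [uIcc_of_le ht.1] at hτ
    simp only [hH]
    rw [indicator_of_mem (mem_Ico.mpr ⟨hτ.1, hτ.2.trans_lt ht.2⟩)]
  intro t ht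
  refine (energy_equation_iff hN hσ₀ hσ₂ ht.1 (ht.2.le.trans hT₁)
    (hGm.mono_measure (Measure.restrict_mono_set _ (hsub t ht)))
    (fun τ hτ => hGM τ (hsub t ht hτ)) (y t)).mpr ⟨(hw t ht).trans (hmild t ht), ?_⟩
  have h := (hasDerivAt_mild hN hσ₀ (w₀ := w₀) (u₁ := u₁) hHm hHM t).hasDerivWithinAt
    (s := Ico 0 T)
  have hcongr : ∀ r ∈ Ico 0 T, v r =
      cosOp σ r (besselOp σ w₀) + sinOp σ r u₁ + duhamel (sinOp σ) H r := fun r hr => by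
    rw [hmild r hr, hcut _ r hr]
  rw [← hcut _ t ht]
  exact (h.congr hcongr (hcongr t ht)).derivWithin (hud t ht)

end MildSolutions

theorem theorem1p1 (N : ℕ) (hN : 0 < N) (σ : ℝ) (hσ₀ : 0 < σ) (hσ₂ : σ ≤ 2)
    (p : ℝ) (hp₁ : 1 < p) (hp₂ : σ < N → p < N / (N - σ))
    (b : ℝ → ℝ) (hb : MemLp b ∞ (volume.restrict (Ioo (0 : ℝ) 1)))
    (f : ℝ → ℝ) (hf₀ : f 0 = 0)
    (hf : ∃ C₀ : ℝ, ∀ z w : ℝ, |f z - f w| ≤ C₀ * (|z| ^ (p - 1) + |w| ^ (p - 1)) * |z - w|)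
    (u₀ u₁ : RealL2 N) (hu₀ : MemHs (σ / 2) u₀) :
    ∃ T : ℝ, 0 < T ∧ T ≤ 1 ∧
      ∃ u : ℝ → RealL2 N, IsMildSolution σ b f u₀ u₁ T u ∧
        ∀ v : ℝ → RealL2 N, IsMildSolution σ b f u₀ u₁ T v → ∀ t ∈ Ico 0 T, v t = u t := by
  obtain ⟨C₀, hf⟩ := hf
  have hgrowth : HasPowerGrowth f p (max C₀ 0) := fun z w => (hf z w).trans (by
    gcongr
    exact le_max_left _ _)
  have hsub : N * (p - 1) < σ * p := by
    rcases lt_or_ge σ (N : ℝ) with h | h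
    · have h1 := hp₂ h
      rw [lt_div_iff₀ (by linarith)] at h1
      linarith
    · nlinarith
  obtain ⟨hspec, hL⟩ := nemytskii_spec hN hσ₀ hp₁ hsub hf₀ (le_max_right _ _) hgrowth
  obtain ⟨b', hb'm, ⟨B, hb'B⟩, hbb'⟩ := exists_bounded_representative hb
  obtain ⟨w₀, rfl⟩ := (memHs_iff hσ₀.le).mp hu₀
  have hK := continuous_uncurry_energyKernel hN hσ₀.le hσ₂
  have hKb := norm_energyKernel_le (N := N) hσ₀.le hσ₂
  have hg₀ : ∀ τ, forcing (N := N) σ b' f τ 0 = 0 := fun τ => by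
    rw [forcing, Prod.fst_zero, Prod.snd_zero, nemytskii_zero hf₀ hspec, smul_zero, sub_zero]
  have hgL := forcing_lipschitz (σ := σ) (f := f) hb'B hL
  have hgm : ∀ (x : ℝ → RealL2 N × RealL2 N) (s : Set ℝ),
      AEStronglyMeasurable x (volume.restrict s) →
      AEStronglyMeasurable (fun τ => forcing σ b' f τ (x τ)) (volume.restrict s) := fun _ _ hx =>
    aestronglyMeasurable_forcing hb'm (continuous_of_lipschitz_on_balls hL) hx
  obtain ⟨T, hT₀, hT₁, x, hx, ⟨R, hR⟩, hxe⟩ := exists_volterra_solution hK hKb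
    (continuous_energyFree hN hσ₀.le hσ₂ w₀ u₁) hg₀ hgL hgm
  have hxe' := fun t (ht : t ∈ Ico 0 T) => hxe t ⟨ht.1, ht.2.le⟩
  refine ⟨T, hT₀, hT₁, fun t => besselOp σ (x t).1,
    isMildSolution_of_volterra hN hσ₀.le hσ₂ hb'm hb'B hbb' hf₀ hspec hL hT₁ hx hR hxe',
    fun v hv t ht => ?_⟩
  obtain ⟨y, hyc, ⟨R', hyR⟩, hvy, hye⟩ :=
    hv.exists_volterra hN hσ₀.le hσ₂ hb'm hb'B hbb' hf₀ hspec hL hT₁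
  have hyx := volterra_solution_unique hK hKb hg₀ hgL hgm (R := max R' R) hT₁ hyc hx.continuousOn
    (fun t ht => (hyR t ht).trans (le_max_left _ _)) (fun t _ => (hR t).trans (le_max_right _ _))
    hye hxe' t ht
  rw [hvy t ht, hyx]
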